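/- Let $N,n,k,t$ be positive integers with $$n\ge 2^{13}\,k\log_2(2k)\qquad\text{and}\qquad n\ge 2^{19}\,t\,k\,\log_2^2\frac nk .$$ Let $\mathcal C\subset 2^{[N]}$ be a simplicial complex, that is, a nonempty family closed under taking subsets, and suppose that every inclusion-maximal set in $\mathcal C$ has at least $n$ elements. Let $\mathcal C^{(k)}$ be the family of all $k$-element sets in $\mathcal C$, and for $T\subset[N]$ let $\mathcal C^{(k)}(T)=\{A\setminus T: A\in\mathcal C^{(k)},\ T\subset A\}$. Let $\mathcal F\subset\mathcal C^{(k)}$ be $t$-intersecting, that is, $|A\cap B|\ge t$ for all (not necessarily distinct) $A,B\in\mathcal F$. Then there exists a set $T\subset[N]$ of size $t$ such that $|\mathcal F|\le|\mathcal C^{(k)}(T)|$. Moreover, if $$m=\min_{T\in\binom{[N]}{t}}\bigl|\{A\in\mathcal F: T\not\subset A\}\bigr| ,$$ then $$|\mathcal F|\le\max\Bigl\{\max_{T\in\binom{[N]}{t}}|\mathcal C^{(k)}(T)|-m\,2^{\,2^{-20}\frac{n}{k\log_2(n/k)}},\ \ 0.6\max_{T\in\binom{[N]}{t}}|\mathcal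 C^{(k)}(T)|\Bigr\}.$$ -/

import Mathlib

namespace UniformHereditary

/-- `C ⊆ 2^[N]` is a simplicial complex: it is nonempty and closed under taking subsets. -/
def IsComplex {N : ℕ} (C : Finset (Finset (Fin N))) : Prop :=
  C.Nonempty ∧ ∀ A ∈ C, ∀ B, B ⊆ A → B ∈ C

/-- The family has rank at least `n`: all its inclusion-maximal members have size at least `n`. -/
def RankGE {N : ℕ} (C : Finset (Finset (Fin N))) (n : ℕ) : Prop :=
  ∀ A, Maximal (· ∈ C) A → n ≤ A.card

/-- `F` is `t`-intersecting: any two (not necessarily distinct) members share at least `t`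
elements. -/
def IsTIntersecting {N : ℕ} (t : ℕ) (F : Finset (Finset (Fin N))) : Prop :=
  ∀ A ∈ F, ∀ B ∈ F, t ≤ (A ∩ B).card

/-- `A[T] = {F : F ∈ A, T ⊆ F}`. -/
def star {N : ℕ} (A : Finset (Finset (Fin N))) (T : Finset (Fin N)) :
    Finset (Finset (Fin N)) :=
  A.filter (fun F => T ⊆ F)

/-- `A(T) = {F \ T : F ∈ A, T ⊆ F}`. -/
def link {N : ℕ} (A : Finset (Finset (Fin N))) (T : Finset (Fin N)) :
    Finset (Finset (Fin N)) :=
  (star A T).image (fun F => F \ T)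

end UniformHereditary

/-!
The proof is the method of spread approximations. Write `ρ = n / k - 2`. A member of the slice
`C.slice k` has a member of `C` with at least `n` elements above each of its subsets, so exchanging
single elements shows that the slice is spread: at most a fraction `ρ ^ (-#(Y \ X))` of its members
containing `X` contain `Y ⊇ X` (`avoidDegree_mul_pow_le`).

The tool that exploits this is the spread lemma: two families of sets of size at most `k` that are
spread with a parameter exceeding a constant times `log k` have disjoint members
(`exists_disjoint_of_spread`). It holds because a uniformly random set contains a member of such a
family with probability more than one half. To see this, the random set is exposed in about
`log k` rounds; in each round the part of a typical member that is still missing is halved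
(`exists_fragment`, where the probability is bounded through minimum fragments). Hence, if
subfamilies of a `t`-intersecting family are spread over sets `S₁` and `S₂`, then
`t ≤ #(S₁ ∩ S₂)` (`card_inter_of_isSpreadOver`).

Let `M` be the largest degree of a `t`-set in the slice. The small sets over which some subfamily of
`F` is spread form a `t`-intersecting family, and nearly all of `F` lies above one of them. Since
these sets have size `O(t * log (n / k))`, which is small compared to `ρ`, replacing them by smaller
and smaller ones (`exists_kernel`) gives a `t`-set `T₀` contained in all but `M / 100` members of
`F` (`exists_card_not_subset_le`).

Suppose `#F > 0.6 * M`, so that `F` has at least `0.59 * M` members through `T₀`, and let `H` be the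
set of the other members. A suitable link of `H` is spread over a set `S` not containing `T₀`, so by
the spread lemma `F` misses at least half of the sets through `T₀` that avoid `S \ T₀`. There are
at least `(1 - 1 / ρ) ^ #S * (0.59 * M)` of these. As `F` misses at most a fraction `0.41` of the
sets through `T₀`, the size of `S` is at least of order `ρ`. On the other hand
`#H ≤ 2 ^ (-#S) * ρ ^ t * M`, so the number of missing sets exceeds `#H` by a factor exponential
in `ρ` (`card_not_subset_mul_add_le`), which is more than the theorem asks for. The first part of
the theorem follows from the second.
-/

namespace UniformHereditary

open Finset

/-! ### Random subsets of a finite set -/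

section BiasedWeight

variable {α : Type*} [DecidableEq α]

/-- A function on finite sets is determined by its sums over the subsets of each set. -/
lemma eq_of_sum_powerset_eq {u v : Finset α → ℝ}
    (h : ∀ W : Finset α, ∑ Z ∈ W.powerset, u Z = ∑ Z ∈ W.powerset, v Z) : u = v := by
  funext W
  induction W using Finset.strongInduction with
  | H W ih =>
    have hW := h W
    rw [← add_sum_erase _ _ (mem_powerset_self W), ← add_sum_erase _ _ (mem_powerset_self W),
      sum_congr rfl fun Z hZ => ih Z ?_] at hW
    · exact add_right_cancel hW
    · rw [mem_erase, mem_powerset] at hZ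
      exact hZ.2.ssubset_of_ne hZ.1

variable [Fintype α]

/-- The probability that a `p`-random subset of `α` (each element is kept independently with
probability `p`) equals `W`. -/
def biasedWeight (p : ℝ) (W : Finset α) : ℝ := p ^ #W * (1 - p) ^ #Wᶜ

lemma biasedWeight_nonneg {p : ℝ} (h0 : 0 ≤ p) (h1 : p ≤ 1) (W : Finset α) :
    0 ≤ biasedWeight p W :=
  mul_nonneg (pow_nonneg h0 _) (pow_nonneg (sub_nonneg.2 h1) _)

lemma sum_powerset_biasedWeight (p : ℝ) (W : Finset α) :
    ∑ Z ∈ W.powerset, biasedWeight p Z = (1 - p) ^ #Wᶜ := by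
  have h : ∀ Z ∈ W.powerset,
      biasedWeight p Z = (p ^ #Z * (1 - p) ^ (#W - #Z)) * (1 - p) ^ #Wᶜ := by
    intro Z hZ
    have hZ := card_le_card (mem_powerset.1 hZ)
    have hW := card_le_univ W
    rw [biasedWeight, mul_assoc, ← pow_add, card_compl, card_compl]
    congr 2
    omega
  rw [sum_congr rfl h, ← sum_mul, sum_pow_mul_eq_add_pow]
  simp

lemma sum_biasedWeight (p : ℝ) : ∑ W : Finset α, biasedWeight p W = 1 := by
  simpa using sum_powerset_biasedWeight p (univ : Finset α)

/-- The union of independent `p`- and `q`-random subsets is `(1 - (1 - p) * (1 - q))`-random. -/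
lemma sum_biasedWeight_union (p q : ℝ) (h : Finset α → ℝ) :
    ∑ A : Finset α, biasedWeight p A * ∑ B : Finset α, biasedWeight q B * h (A ∪ B) =
      ∑ W : Finset α, biasedWeight (1 - (1 - p) * (1 - q)) W * h W := by
  have key : (fun W : Finset α => ∑ x : Finset α × Finset α with x.1 ∪ x.2 = W,
      biasedWeight p x.1 * biasedWeight q x.2) =
      biasedWeight (1 - (1 - p) * (1 - q)) := by
    apply eq_of_sum_powerset_eq
    intro W
    rw [sum_powerset_biasedWeight, sub_sub_cancel, mul_pow, ← sum_powerset_biasedWeight p W,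
      ← sum_powerset_biasedWeight q W, sum_mul_sum, ← sum_product',
      ← sum_fiberwise_of_maps_to (t := W.powerset) (g := fun x : Finset α × Finset α => x.1 ∪ x.2)]
    · refine sum_congr rfl fun Z hZ => sum_congr ?_ fun _ _ => rfl
      ext x
      simp only [mem_filter, mem_univ, true_and, mem_product, mem_powerset] at hZ ⊢
      refine ⟨fun hx => ⟨⟨?_, ?_⟩, hx⟩, fun hx => hx.2⟩
      · exact subset_union_left.trans (hx.subset.trans hZ)
      · exact subset_union_right.trans (hx.subset.trans hZ)
    · intro x hx
      rw [mem_product, mem_powerset, mem_powerset] at hx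
      exact mem_powerset.2 (union_subset hx.1 hx.2)
  rw [← key]
  simp_rw [mul_sum, sum_mul]
  rw [← sum_product' (f := fun A B => biasedWeight p A * (biasedWeight q B * h (A ∪ B))),
    univ_product_univ, ← sum_fiberwise univ (fun x : Finset α × Finset α => x.1 ∪ x.2)]
  refine sum_congr rfl fun W _ => sum_congr rfl fun x hx => ?_
  rw [(mem_filter.1 hx).2, mul_assoc]

/-- Removing a set `T` from `W ∪ T` costs a factor of at most `p ^ #T` in probability. -/
lemma biasedWeight_le_union {p : ℝ} (h0 : 0 < p) (h1 : p ≤ 1) {W T : Finset α}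
    (hd : Disjoint W T) : biasedWeight p W ≤ biasedWeight p (W ∪ T) * (p⁻¹) ^ #T := by
  have hc : #(W ∪ T)ᶜ ≤ #Wᶜ := card_le_card (compl_subset_compl.2 subset_union_left)
  rw [biasedWeight, biasedWeight, card_union_of_disjoint hd, pow_add]
  have : p ^ #W * p ^ #T * (1 - p) ^ #(W ∪ T)ᶜ * p⁻¹ ^ #T =
      p ^ #W * (1 - p) ^ #(W ∪ T)ᶜ * (p * p⁻¹) ^ #T := by rw [mul_pow]; ring
  rw [this, mul_inv_cancel₀ h0.ne', one_pow, mul_one]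
  exact mul_le_mul_of_nonneg_left
    (pow_le_pow_of_le_one (sub_nonneg.2 h1) (by linarith) hc) (by positivity)

end BiasedWeight

/-! ### Minimum fragments and the spread lemma -/

section SpreadLemma

variable {α ι : Type*}

/-- The indicator of the event that `W` contains none of the sets `f i`, `i ∈ I`. -/
noncomputable def missIndicator (I : Finset ι) (f : ι → Finset α) (W : Finset α) : ℝ :=
  open Classical in if ∃ i ∈ I, f i ⊆ W then 0 else 1

lemma missIndicator_nonneg (I : Finset ι) (f : ι → Finset α) (W : Finset α) :
    0 ≤ missIndicator I f W := by
  unfold missIndicator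
  split_ifs <;> norm_num

lemma missIndicator_le_one (I : Finset ι) (f : ι → Finset α) (W : Finset α) :
    missIndicator I f W ≤ 1 := by
  unfold missIndicator
  split_ifs <;> norm_num

variable [Fintype α] [DecidableEq α]

/-- One round of exposure. For a random `W` and `i ∈ I`, the fragment `g W i` is a smallest set of
the form `f j \ W` with `f j ⊆ W ∪ f i`. Every `f j` inside `Z = W ∪ g W i` contains the fragment,
so the fragment is among the `2 ^ ℓ` subsets of one set that depends on `Z` only; this makes
large fragments unlikely if `f` is spread. -/
lemma exists_fragment (I : Finset ι) (f : ι → Finset α) {ℓ b : ℕ} {p R K : ℝ} (hp : 0 < p)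
    (hp1 : p ≤ 1) (hR : 1 ≤ p * R) (hK : 0 ≤ K) (hℓ : ∀ i ∈ I, #(f i) ≤ ℓ)
    (hf : ∀ X : Finset α, (#{i ∈ I | X ⊆ f i} : ℝ) * R ^ #X ≤ K) :
    ∃ g : Finset α → ι → Finset α,
      (∀ W, ∀ i ∈ I, g W i ⊆ f i ∧ ∃ j ∈ I, f j \ W = g W i) ∧
      ∑ W : Finset α, biasedWeight p W * (#{i ∈ I | b ≤ #(g W i)} : ℝ) ≤
        K * (2 ^ ℓ / (p * R) ^ b) := by
  classical
  have hRp : 0 < R := by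
    by_contra h
    nlinarith
  have hmin : ∀ W : Finset α, ∀ i : ι, ∃ T : Finset α, i ∈ I →
      (∃ j ∈ I, f j ⊆ W ∪ f i ∧ f j \ W = T) ∧
      ∀ j ∈ I, f j ⊆ W ∪ f i → #T ≤ #(f j \ W) := by
    intro W i
    by_cases hi : i ∈ I
    · obtain ⟨j, hj, hjm⟩ := exists_min_image {j ∈ I | f j ⊆ W ∪ f i} (fun j => #(f j \ W))
        ⟨i, mem_filter.2 ⟨hi, subset_union_right⟩⟩
      rw [mem_filter] at hj
      exact ⟨f j \ W, fun _ => ⟨⟨j, hj.1, hj.2, rfl⟩,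
        fun j' h1 h2 => hjm j' (mem_filter.2 ⟨h1, h2⟩)⟩⟩
    · exact ⟨∅, fun h => absurd h hi⟩
  choose g hg using hmin
  have hgf : ∀ W, ∀ i ∈ I, g W i ⊆ f i := by
    intro W i hi
    obtain ⟨j, -, hj, hjg⟩ := (hg W i hi).1
    rw [← hjg]
    intro x hx
    rw [mem_sdiff] at hx
    exact (mem_union.1 (hj hx.1)).resolve_left hx.2
  have hgW : ∀ W, ∀ i ∈ I, Disjoint W (g W i) := by
    intro W i hi
    obtain ⟨j, -, -, hjg⟩ := (hg W i hi).1
    rw [← hjg]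
    exact disjoint_sdiff
  refine ⟨g, fun W i hi => ⟨hgf W i hi, ?_⟩, ?_⟩
  · obtain ⟨j, hj, -, hjg⟩ := (hg W i hi).1
    exact ⟨j, hj, hjg⟩
  have hchoose : ∀ Z : Finset α, ∃ S : Finset α, #S ≤ ℓ ∧
      ((∃ j ∈ I, f j ⊆ Z) → ∃ j ∈ I, f j ⊆ Z ∧ f j = S) := by
    intro Z
    by_cases h : ∃ j ∈ I, f j ⊆ Z
    · obtain ⟨j, hj, hjZ⟩ := h
      exact ⟨f j, hℓ j hj, fun _ => ⟨j, hj, hjZ, rfl⟩⟩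
    · exact ⟨∅, by simp, fun h' => absurd h' h⟩
  choose S hSℓ hS using hchoose
  have hsub : ∀ W, ∀ i ∈ I, g W i ⊆ S (W ∪ g W i) := by
    intro W i hi
    obtain ⟨j, hj, -, hjg⟩ := (hg W i hi).1
    obtain ⟨j', hj', hj'Z, hj'S⟩ := hS (W ∪ g W i) ⟨j, hj, by
      rw [← hjg, union_sdiff_self_eq_union]; exact subset_union_right⟩
    rw [← hj'S]
    have hle := (hg W i hi).2 j' hj' (hj'Z.trans (union_subset_union_right (hgf W i hi)))
    have hs : f j' \ W ⊆ g W i := by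
      intro x hx
      rw [mem_sdiff] at hx
      exact (mem_union.1 (hj'Z hx.1)).resolve_left hx.2
    rw [← eq_of_subset_of_card_le hs hle]
    exact sdiff_subset
  -- The pairs `(W, i)` with a large fragment inject into the triples `(Z, T, i)`.
  let P : Finset (Finset α × ι) := {x ∈ (univ : Finset (Finset α)) ×ˢ I | b ≤ #(g x.1 x.2)}
  let e : Finset α × ι → (Finset α × Finset α) × ι :=
    fun x => ((x.1 ∪ g x.1 x.2, g x.1 x.2), x.2)
  let Q : Finset ((Finset α × Finset α) × ι) :=
    {y ∈ ((univ : Finset (Finset α)) ×ˢ univ) ×ˢ I |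
      (y.1.2 ⊆ S y.1.1 ∧ b ≤ #y.1.2) ∧ y.1.2 ⊆ f y.2}
  let c : (Finset α × Finset α) × ι → ℝ := fun y => biasedWeight p y.1.1 * p⁻¹ ^ #y.1.2
  have hc : ∀ y, 0 ≤ c y := fun y =>
    mul_nonneg (biasedWeight_nonneg hp.le hp1 _) (by positivity)
  have hP : ∀ x ∈ P, x.2 ∈ I ∧ b ≤ #(g x.1 x.2) := by
    intro x hx
    simpa [P] using hx
  have he : Set.InjOn e P := by
    intro x hx y hy hxy
    simp only [e, Prod.mk.injEq] at hxy
    have h1 := hgW x.1 x.2 (hP x hx).1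
    have h2 := hgW y.1 y.2 (hP y hy).1
    refine Prod.ext ?_ hxy.2
    rw [← union_sdiff_cancel_right h1, hxy.1.1, hxy.1.2, union_sdiff_cancel_right h2]
  have hmaps : P.image e ⊆ Q := by
    intro y hy
    obtain ⟨x, hx, rfl⟩ := mem_image.1 hy
    obtain ⟨hi, hb⟩ := hP x hx
    simp only [Q, e, mem_filter, mem_product, mem_univ, true_and]
    exact ⟨hi, ⟨hsub _ _ hi, hb⟩, hgf _ _ hi⟩
  calc ∑ W : Finset α, biasedWeight p W * (#{i ∈ I | b ≤ #(g W i)} : ℝ)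
      = ∑ x ∈ P, biasedWeight p x.1 := by
        simp only [P, sum_filter, sum_product]
        refine sum_congr rfl fun W _ => ?_
        rw [← sum_filter, sum_const, nsmul_eq_mul, mul_comm]
    _ ≤ ∑ x ∈ P, c (e x) :=
        sum_le_sum fun x hx => biasedWeight_le_union hp hp1 (hgW _ _ (hP x hx).1)
    _ = ∑ y ∈ P.image e, c y := (sum_image he).symm
    _ ≤ ∑ y ∈ Q, c y := sum_le_sum_of_subset_of_nonneg hmaps fun y _ _ => hc y
    _ = ∑ Z : Finset α, ∑ T ∈ (S Z).powerset with b ≤ #T,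
          biasedWeight p Z * p⁻¹ ^ #T * (#{i ∈ I | T ⊆ f i} : ℝ) := by
        simp only [Q, sum_filter, sum_product]
        refine sum_congr rfl fun Z _ => ?_
        rw [← sum_filter, ← sum_subset (subset_univ {T ∈ (S Z).powerset | b ≤ #T})]
        · refine sum_congr rfl fun T hT => ?_
          rw [mem_filter, mem_powerset] at hT
          simp only [hT.1, hT.2, true_and]
          rw [← sum_filter, sum_const (biasedWeight p Z * p⁻¹ ^ #T), nsmul_eq_mul, mul_comm]
        · intro T _ hT
          rw [mem_filter, mem_powerset] at hT
          exact sum_eq_zero fun i _ => if_neg fun h => hT h.1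
    _ ≤ ∑ Z : Finset α, biasedWeight p Z * (K * (2 ^ ℓ / (p * R) ^ b)) := by
        refine sum_le_sum fun Z _ => ?_
        have hT : ∀ T ∈ {T ∈ (S Z).powerset | b ≤ #T},
            biasedWeight p Z * p⁻¹ ^ #T * (#{i ∈ I | T ⊆ f i} : ℝ) ≤
              biasedWeight p Z * (K * ((p * R) ^ b)⁻¹) := by
          intro T hT
          rw [mul_assoc]
          refine mul_le_mul_of_nonneg_left ?_ (biasedWeight_nonneg hp.le hp1 _)
          have h1 : (#{i ∈ I | T ⊆ f i} : ℝ) ≤ K * (R ^ #T)⁻¹ := by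
            rw [← div_eq_mul_inv, le_div_iff₀ (by positivity)]
            exact hf T
          calc p⁻¹ ^ #T * (#{i ∈ I | T ⊆ f i} : ℝ) ≤ p⁻¹ ^ #T * (K * (R ^ #T)⁻¹) := by gcongr
            _ = K * ((p * R) ^ #T)⁻¹ := by rw [mul_pow, mul_inv, inv_pow]; ring
            _ ≤ K * ((p * R) ^ b)⁻¹ := by
              have := pow_le_pow_right₀ hR (mem_filter.1 hT).2
              gcongr
        refine (sum_le_sum hT).trans ?_
        rw [sum_const, nsmul_eq_mul]
        have hcard : (#{T ∈ (S Z).powerset | b ≤ #T} : ℝ) ≤ 2 ^ ℓ := by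
          have h1 : #{T ∈ (S Z).powerset | b ≤ #T} ≤ 2 ^ ℓ := by
            refine (card_filter_le _ _).trans ?_
            rw [card_powerset]
            exact Nat.pow_le_pow_right two_pos (hSℓ Z)
          exact_mod_cast h1
        have h0 : 0 ≤ biasedWeight p Z * (K * ((p * R) ^ b)⁻¹) :=
          mul_nonneg (biasedWeight_nonneg hp.le hp1 _) (by positivity)
        calc _ ≤ 2 ^ ℓ * (biasedWeight p Z * (K * ((p * R) ^ b)⁻¹)) :=
              mul_le_mul_of_nonneg_right hcard h0
          _ = _ := by ring
    _ = K * (2 ^ ℓ / (p * R) ^ b) := by rw [← sum_mul, sum_biasedWeight, one_mul]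

/-- Iterating `exists_fragment`: each round halves the sizes, and the indices with a fragment
that is too large are discarded. The bound `K` of the spread condition stays the same, so that
`K - #I` records the loss. -/
lemma miss_prob_le {p R K : ℝ} (hp : 0 < p) (hp1 : p ≤ 1) (hR : 16 ≤ p * R) (hK : 0 ≤ K) :
    ∀ (m : ℕ) (I : Finset ι) (f : ι → Finset α), (∀ i ∈ I, #(f i) < 2 ^ m) →
      (∀ X : Finset α, (#{i ∈ I | X ⊆ f i} : ℝ) * R ^ #X ≤ K) →
      K * ∑ W : Finset α, biasedWeight (1 - (1 - p) ^ m) W * missIndicator I f W ≤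
        K - #I + K * (1 / 3 - 1 / 3 * (1 / 4) ^ m) := by
  classical
  have hRp : 0 < R := by
    by_contra h
    nlinarith
  intro m
  induction m with
  | zero =>
    intro I f hcard hf
    have hI : (#I : ℝ) ≤ K := by simpa using hf ∅
    rcases I.eq_empty_or_nonempty with rfl | ⟨i, hi⟩
    · have h : ∑ W : Finset α, biasedWeight (1 - (1 - p) ^ 0) W *
          missIndicator (∅ : Finset ι) f W = 1 := by
        simpa [missIndicator] using sum_biasedWeight (α := α) 0
      rw [h]
      simp
    · have h : ∀ W : Finset α, missIndicator I f W = 0 := by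
        intro W
        have : f i = ∅ := by simpa using hcard i hi
        exact if_pos ⟨i, hi, by simp [this]⟩
      simp only [h, mul_zero, sum_const_zero]
      simpa using hI
  | succ m ih =>
    intro I f hcard hf
    obtain ⟨g, hg, hsum⟩ := exists_fragment I f (b := 2 ^ m) hp hp1 (by linarith) hK
      (fun i hi => (hcard i hi).le) hf
    set J : Finset α → Finset ι := fun W => {i ∈ I | ¬ 2 ^ m ≤ #(g W i)} with hJ
    have hJI : ∀ W, (#(J W) : ℝ) = #I - #{i ∈ I | 2 ^ m ≤ #(g W i)} := by
      intro W
      rw [eq_sub_iff_add_eq', ← Nat.cast_add]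
      exact congrArg _ (card_filter_add_card_filter_not _)
    have hih : ∀ W, K * ∑ W' : Finset α, biasedWeight (1 - (1 - p) ^ m) W' *
        missIndicator (J W) (g W) W' ≤
          K - #(J W) + K * (1 / 3 - 1 / 3 * (1 / 4) ^ m) := by
      intro W
      refine ih (J W) (g W) (fun i hi => not_le.1 (mem_filter.1 hi).2) fun X => ?_
      refine le_trans (mul_le_mul_of_nonneg_right ?_ (by positivity)) (hf X)
      exact_mod_cast card_le_card fun i hi => by
        rw [mem_filter] at hi ⊢
        have hiI := (mem_filter.1 hi.1).1
        exact ⟨hiI, hi.2.trans (hg W i hiI).1⟩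
    have hmiss : ∀ W W', missIndicator I f (W ∪ W') ≤ missIndicator (J W) (g W) W' := by
      intro W W'
      by_cases h : ∃ i ∈ J W, g W i ⊆ W'
      · obtain ⟨i, hi, hiW⟩ := h
        obtain ⟨j, hj, hjg⟩ := (hg W i (mem_filter.1 hi).1).2
        have : missIndicator I f (W ∪ W') = 0 :=
          if_pos ⟨j, hj, sdiff_le_iff.1 (hjg.le.trans hiW)⟩
        rw [this]
        exact missIndicator_nonneg _ _ _
      · have : missIndicator (J W) (g W) W' = 1 := if_neg h
        rw [this]
        exact missIndicator_le_one _ _ _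
    have hq0 : 0 ≤ 1 - (1 - p) ^ m :=
      sub_nonneg.2 (pow_le_one₀ (by linarith) (by linarith))
    have hq1 : 1 - (1 - p) ^ m ≤ 1 := by
      have : 0 ≤ (1 - p) ^ m := pow_nonneg (by linarith) _
      linarith
    -- The fragments of size at least `2 ^ m` carry a share of at most `(4 / 16) ^ (2 ^ m)`.
    have hloss : K * ((2 : ℝ) ^ (2 ^ (m + 1)) / (p * R) ^ (2 ^ m)) ≤ K * (1 / 4) ^ (m + 1) := by
      refine mul_le_mul_of_nonneg_left ?_ hK
      calc ((2 : ℝ) ^ (2 ^ (m + 1)) / (p * R) ^ (2 ^ m))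
          ≤ (2 : ℝ) ^ (2 ^ (m + 1)) / 16 ^ (2 ^ m) := by gcongr
        _ = (1 / 4) ^ (2 ^ m) := by
          rw [pow_succ 2 m, mul_comm, pow_mul, ← div_pow]
          norm_num
        _ ≤ (1 / 4) ^ (m + 1) :=
          pow_le_pow_of_le_one (by norm_num) (by norm_num) Nat.lt_two_pow_self
    have hpm : 1 - (1 - p) ^ (m + 1) = 1 - (1 - p) * (1 - (1 - (1 - p) ^ m)) := by ring
    rw [hpm, ← sum_biasedWeight_union]
    calc K * ∑ A : Finset α, biasedWeight p A * ∑ B : Finset α,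
          biasedWeight (1 - (1 - p) ^ m) B * missIndicator I f (A ∪ B)
        ≤ K * ∑ A : Finset α, biasedWeight p A * ∑ B : Finset α,
          biasedWeight (1 - (1 - p) ^ m) B * missIndicator (J A) (g A) B := by
          refine mul_le_mul_of_nonneg_left (sum_le_sum fun A _ => ?_) hK
          refine mul_le_mul_of_nonneg_left (sum_le_sum fun B _ => ?_)
            (biasedWeight_nonneg hp.le hp1 _)
          exact mul_le_mul_of_nonneg_left (hmiss A B) (biasedWeight_nonneg hq0 hq1 _)
      _ = ∑ A : Finset α, biasedWeight p A * (K * ∑ B : Finset α,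
          biasedWeight (1 - (1 - p) ^ m) B * missIndicator (J A) (g A) B) := by
          rw [mul_sum]
          exact sum_congr rfl fun A _ => by ring
      _ ≤ ∑ A : Finset α, biasedWeight p A * (K - #I + K * (1 / 3 - 1 / 3 * (1 / 4) ^ m) +
          #{i ∈ I | 2 ^ m ≤ #(g A i)}) := by
          refine sum_le_sum fun A _ => mul_le_mul_of_nonneg_left ?_
            (biasedWeight_nonneg hp.le hp1 _)
          have := hih A
          rw [hJI] at this
          linarith
      _ = K - #I + K * (1 / 3 - 1 / 3 * (1 / 4) ^ m) +
          ∑ A : Finset α, biasedWeight p A * (#{i ∈ I | 2 ^ m ≤ #(g A i)} : ℝ) := by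
          simp_rw [mul_add _ _ ((#_ : ℕ) : ℝ)]
          rw [sum_add_distrib, ← sum_mul, sum_biasedWeight, one_mul]
      _ ≤ K - #I + K * (1 / 3 - 1 / 3 * (1 / 4) ^ (m + 1)) := by
          have h := hsum.trans hloss
          have h4 : K * (1 / 4 : ℝ) ^ (m + 1) = K * (1 / 4) ^ m * (1 / 4) := by ring
          have h5 : K * (1 / 3 - 1 / 3 * (1 / 4 : ℝ) ^ (m + 1)) =
            K * (1 / 3) - 1 / 12 * (K * (1 / 4) ^ m) := by ring
          rw [h5]
          rw [h4] at h
          nlinarith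

/-- A uniformly random set contains a member of a nonempty spread family with probability at
least `2 / 3`. -/
lemma half_miss_prob_le {R : ℝ} {m : ℕ} (hm : 0 < m) (hR : 32 * m ≤ R) (I : Finset ι)
    (hI : I.Nonempty) (f : ι → Finset α) (hcard : ∀ i ∈ I, #(f i) < 2 ^ m)
    (hf : ∀ X : Finset α, (#{i ∈ I | X ⊆ f i} : ℝ) * R ^ #X ≤ #I) :
    ∑ W : Finset α, biasedWeight (1 / 2) W * missIndicator I f W ≤ 1 / 3 := by
  have hm' : (0 : ℝ) < m := by exact_mod_cast hm
  have hm1 : (1 : ℝ) ≤ m := by exact_mod_cast hm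
  -- With this `p`, the union of `m` independent `p`-random sets is uniformly random.
  set p : ℝ := 1 - (1 / 2 : ℝ) ^ ((m : ℝ)⁻¹) with hp
  have hpm : (1 - p) ^ m = 1 / 2 := by
    rw [hp, sub_sub_cancel]
    exact Real.rpow_inv_natCast_pow (by norm_num) hm.ne'
  have hp1 : p ≤ 1 := by
    have : (0 : ℝ) ≤ (1 / 2 : ℝ) ^ ((m : ℝ)⁻¹) := by positivity
    linarith
  have hp2 : 1 / (2 * m) ≤ p := by
    by_contra! h
    have h1 : (1 / 2 : ℝ) ≤ (1 - 1 / (2 * m)) ^ m := by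
      have h2 : (1 / (2 * m) : ℝ) ≤ 1 / 2 := by
        rw [div_le_div_iff₀ (by positivity) (by norm_num)]
        linarith
      have := one_add_mul_le_pow (a := -(1 / (2 * m) : ℝ)) (by linarith) m
      have h3 : (1 : ℝ) + m * -(1 / (2 * m)) = 1 / 2 := by field_simp; norm_num
      rw [h3] at this
      simpa [sub_eq_add_neg] using this
    have h2 : (1 - 1 / (2 * m) : ℝ) ^ m < (1 - p) ^ m := by
      refine pow_lt_pow_left₀ (by linarith) ?_ hm.ne'
      have h2 : (1 / (2 * m) : ℝ) ≤ 1 / 2 := by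
        rw [div_le_div_iff₀ (by positivity) (by norm_num)]
        linarith
      linarith
    rw [hpm] at h2
    linarith
  have hp0 : 0 < p := lt_of_lt_of_le (by positivity) hp2
  have hpR : 16 ≤ p * R := by
    calc (16 : ℝ) = 1 / (2 * m) * (32 * m) := by field_simp; norm_num
      _ ≤ p * R := by gcongr
  have h := miss_prob_le hp0 hp1 hpR (Nat.cast_nonneg #I) m I f hcard hf
  rw [hpm, sub_self, zero_add] at h
  have hI0 : (0 : ℝ) < #I := by exact_mod_cast hI.card_pos
  have h' := le_of_mul_le_mul_left h hI0
  have h4 : (0 : ℝ) ≤ 1 / 3 * (1 / 4) ^ m := by positivity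
  rw [show (1 - 1 / 2 : ℝ) = 1 / 2 by norm_num] at h'
  linarith

/-- Two spread families have disjoint members: a random set contains a member of the first while
its complement contains a member of the second. -/
theorem exists_disjoint_of_spread {κ : Type*} {R : ℝ} {m : ℕ} (hm : 0 < m) (hR : 32 * m ≤ R)
    (I : Finset ι) (hI : I.Nonempty) (f : ι → Finset α) (hcard : ∀ i ∈ I, #(f i) < 2 ^ m)
    (hf : ∀ X : Finset α, (#{i ∈ I | X ⊆ f i} : ℝ) * R ^ #X ≤ #I)
    (J : Finset κ) (hJ : J.Nonempty) (g : κ → Finset α) (hcard' : ∀ j ∈ J, #(g j) < 2 ^ m)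
    (hg : ∀ X : Finset α, (#{j ∈ J | X ⊆ g j} : ℝ) * R ^ #X ≤ #J) :
    ∃ i ∈ I, ∃ j ∈ J, Disjoint (f i) (g j) := by
  have h1 := half_miss_prob_le hm hR I hI f hcard hf
  have h2 := half_miss_prob_le hm hR J hJ g hcard' hg
  have h3 : ∑ W : Finset α, biasedWeight (1 / 2) W * missIndicator J g Wᶜ =
      ∑ W : Finset α, biasedWeight (1 / 2) W * missIndicator J g W := by
    refine sum_equiv (Equiv.mk compl compl compl_compl compl_compl) (by simp) fun W _ => ?_
    simp only [Equiv.coe_fn_mk, biasedWeight, compl_compl]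
    ring
  have h4 : ∑ W : Finset α, biasedWeight (1 / 2) W *
      (missIndicator I f W + missIndicator J g Wᶜ) < ∑ W : Finset α, biasedWeight (1 / 2) W := by
    simp_rw [mul_add]
    rw [sum_add_distrib, h3, sum_biasedWeight]
    linarith
  obtain ⟨W, -, hW⟩ := exists_lt_of_sum_lt h4
  have hw : 0 ≤ biasedWeight (1 / 2) W := biasedWeight_nonneg (by norm_num) (by norm_num) W
  have hW1 : ∃ i ∈ I, f i ⊆ W := by
    by_contra h
    have : missIndicator I f W = 1 := if_neg h
    have := missIndicator_nonneg J g Wᶜ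
    nlinarith
  have hW2 : ∃ j ∈ J, g j ⊆ Wᶜ := by
    by_contra h
    have : missIndicator J g Wᶜ = 1 := if_neg h
    have := missIndicator_nonneg I f W
    nlinarith
  obtain ⟨i, hi, hiW⟩ := hW1
  obtain ⟨j, hj, hjW⟩ := hW2
  exact ⟨i, hi, j, hj, Disjoint.mono hiW hjW disjoint_compl_right⟩

end SpreadLemma

/-! ### Spread families -/

/-- The nonempty family `G` consists of sets containing `S`, and for every `X ⊇ S` at most a
fraction `R ^ (-#(X \ S))` of its members contain `X`. -/
structure IsSpreadOver {α : Type*} [DecidableEq α] (R : ℝ) (S : Finset α)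
    (G : Finset (Finset α)) : Prop where
  nonempty : G.Nonempty
  subset : ∀ A ∈ G, S ⊆ A
  card_le : ∀ X, S ⊆ X → (#{A ∈ G | X ⊆ A} : ℝ) * R ^ #(X \ S) ≤ #G

section Spread

variable {α : Type*} [DecidableEq α]

lemma IsSpreadOver.mono {R R' : ℝ} {S : Finset α} {G : Finset (Finset α)}
    (h : IsSpreadOver R S G) (h0 : 0 ≤ R') (hR : R' ≤ R) : IsSpreadOver R' S G :=
  ⟨h.nonempty, h.subset, fun X hX =>
    le_trans (mul_le_mul_of_nonneg_left (pow_le_pow_left₀ h0 hR _) (Nat.cast_nonneg _))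
      (h.card_le X hX)⟩

/-- A subfamily with at least half the size of the bounding number `K` of a spread condition is
spread, with half the parameter. -/
lemma isSpreadOver_half {R K : ℝ} {S : Finset α} {G : Finset (Finset α)}
    (hG : G.Nonempty) (hS : ∀ A ∈ G, S ⊆ A) (hK : K ≤ 2 * #G)
    (h : ∀ X, S ⊆ X → (#{A ∈ G | X ⊆ A} : ℝ) * R ^ #(X \ S) ≤ K) :
    IsSpreadOver (R / 2) S G := by
  refine ⟨hG, hS, fun X hX => ?_⟩
  rcases (#(X \ S)).eq_zero_or_pos with h0 | h0
  · rw [h0, pow_zero, mul_one]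
    exact_mod_cast card_filter_le _ _
  · have h2 : (2 : ℝ) ≤ 2 ^ #(X \ S) := by
      calc (2 : ℝ) = 2 ^ 1 := (pow_one _).symm
        _ ≤ _ := pow_le_pow_right₀ (by norm_num) h0
    have h3 := (h X hX).trans hK
    rw [div_pow, mul_div_assoc', div_le_iff₀ (by positivity)]
    have : (0 : ℝ) ≤ #G := Nat.cast_nonneg _
    nlinarith

/-- Every family has a link that is spread: take `S` of maximum size such that the members
containing `S` are at least a fraction `R ^ (-#S)` of all. -/
lemma exists_isSpreadOver [Fintype α] {R : ℝ} (hR : 0 < R) {H : Finset (Finset α)}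
    (hH : H.Nonempty) :
    ∃ S, (#H : ℝ) ≤ R ^ #S * #{A ∈ H | S ⊆ A} ∧ IsSpreadOver R S {A ∈ H | S ⊆ A} := by
  classical
  obtain ⟨S, hS, hmax⟩ := exists_max_image
    {S : Finset α | (#H : ℝ) ≤ R ^ #S * #{A ∈ H | S ⊆ A}} card ⟨∅, by simp⟩
  rw [mem_filter] at hS
  have hpos : (0 : ℝ) < #H := by exact_mod_cast hH.card_pos
  refine ⟨S, hS.2, ?_, fun A hA => (mem_filter.1 hA).2, fun X hX => ?_⟩
  · rw [nonempty_iff_ne_empty]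
    intro h
    have := hS.2
    rw [h, card_empty, Nat.cast_zero, mul_zero] at this
    linarith
  · have hfil : {A ∈ {A ∈ H | S ⊆ A} | X ⊆ A} = {A ∈ H | X ⊆ A} := by
      ext A
      simp only [mem_filter, and_assoc, and_congr_right_iff]
      exact fun _ => ⟨fun h => h.2, fun h => ⟨hX.trans h, h⟩⟩
    rw [hfil]
    rcases eq_or_ne S X with rfl | hne
    · simp
    · have hlt : #S < #X := card_lt_card (hX.ssubset_of_ne hne)
      have hX' : R ^ #X * #{A ∈ H | X ⊆ A} < #H := by
        by_contra! h
        exact absurd (hmax X (mem_filter.2 ⟨mem_univ _, h⟩)) (not_le.2 hlt)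
      have hpow : R ^ #X = R ^ #S * R ^ #(X \ S) := by
        rw [← pow_add, add_comm, card_sdiff_add_card_eq_card hX]
      have := hX'.le.trans hS.2
      rw [hpow, mul_assoc] at this
      have := le_of_mul_le_mul_left this (pow_pos hR _)
      linarith

/-- Most members of a family that is spread over `S` avoid a given small set disjoint from `S`. -/
lemma IsSpreadOver.filter_disjoint {R : ℝ} {S T : Finset α} {G : Finset (Finset α)}
    (h : IsSpreadOver R S G) (hR : 0 ≤ R) (hT : 2 * (#T : ℝ) ≤ R) :
    IsSpreadOver (R / 2) S {A ∈ G | Disjoint A (T \ S)} := by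
  have hGpos : (0 : ℝ) < #G := by exact_mod_cast h.nonempty.card_pos
  have hbad : ∀ x ∈ T \ S, (#{A ∈ G | x ∈ A} : ℝ) * R ≤ #G := by
    intro x hx
    have hxS := (mem_sdiff.1 hx).2
    have := h.card_le (insert x S) (subset_insert _ _)
    rw [insert_sdiff_of_notMem _ hxS, sdiff_self, card_insert_of_notMem (by simp)] at this
    refine le_trans (mul_le_mul_of_nonneg_right ?_ hR) (by simpa using this)
    exact_mod_cast card_le_card fun A hA => by
      rw [mem_filter] at hA ⊢
      exact ⟨hA.1, insert_subset hA.2 (h.subset A hA.1)⟩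
  have hcover : {A ∈ G | ¬ Disjoint A (T \ S)} ⊆ (T \ S).biUnion fun x => {A ∈ G | x ∈ A} := by
    intro A hA
    rw [mem_filter, not_disjoint_iff] at hA
    obtain ⟨hA, x, hxA, hx⟩ := hA
    exact mem_biUnion.2 ⟨x, hx, mem_filter.2 ⟨hA, hxA⟩⟩
  have hsum : (#{A ∈ G | ¬ Disjoint A (T \ S)} : ℝ) * 2 ≤ #G := by
    rcases hR.eq_or_lt with h0 | h0
    · have hT0 : T = ∅ := by
        have h1 : (0 : ℝ) ≤ #T := Nat.cast_nonneg _
        have h2 : (#T : ℝ) = 0 := by linarith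
        exact card_eq_zero.1 (by exact_mod_cast h2)
      simp [hT0]
    · have h1 : (#{A ∈ G | ¬ Disjoint A (T \ S)} : ℝ) ≤ ∑ x ∈ T \ S, (#{A ∈ G | x ∈ A} : ℝ) := by
        exact_mod_cast (card_le_card hcover).trans card_biUnion_le
      have h2 : (∑ x ∈ T \ S, (#{A ∈ G | x ∈ A} : ℝ)) * R ≤ #T * #G := by
        rw [sum_mul]
        refine (sum_le_sum hbad).trans ?_
        rw [sum_const, nsmul_eq_mul]
        gcongr
        exact sdiff_subset
      have h3 := mul_le_mul_of_nonneg_right h1 hR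
      have h4 : ((#{A ∈ G | ¬ Disjoint A (T \ S)} : ℝ) * 2) * R ≤ #G * R := by nlinarith
      exact le_of_mul_le_mul_right h4 h0
  have hadd : (#{A ∈ G | Disjoint A (T \ S)} : ℝ) + #{A ∈ G | ¬ Disjoint A (T \ S)} = #G := by
    exact_mod_cast card_filter_add_card_filter_not _
  refine isSpreadOver_half (K := #G) ?_ (fun A hA => h.subset A (mem_filter.1 hA).1)
    (by linarith) fun X hX => ?_
  · rw [← card_pos]
    have : (0 : ℝ) < #{A ∈ G | Disjoint A (T \ S)} := by linarith
    exact_mod_cast this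
  · refine le_trans (mul_le_mul_of_nonneg_right ?_ (by positivity)) (h.card_le X hX)
    exact_mod_cast card_le_card (filter_subset_filter _ (filter_subset _ _))

lemma IsSpreadOver.card_filter_sdiff {R : ℝ} {S : Finset α} {G : Finset (Finset α)}
    (h : IsSpreadOver R S G) (hR : 0 ≤ R) (X : Finset α) :
    (#{A ∈ G | X ⊆ A \ S} : ℝ) * R ^ #X ≤ #G := by
  by_cases hX : Disjoint X S
  · have := h.card_le (X ∪ S) subset_union_right
    rw [union_sdiff_cancel_right hX] at this
    refine le_trans (mul_le_mul_of_nonneg_right ?_ (by positivity)) this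
    exact_mod_cast card_le_card fun A hA => by
      rw [mem_filter] at hA ⊢
      exact ⟨hA.1, union_subset (hA.2.trans sdiff_subset) (h.subset A hA.1)⟩
  · have : {A ∈ G | X ⊆ A \ S} = ∅ :=
      filter_eq_empty_iff.2 fun A _ hA => hX (sdiff_disjoint.mono_left hA)
    rw [this]
    simp

/-- Families spread over `S₁` and `S₂`, each avoiding the part of the other set outside its own,
have members that intersect in `S₁ ∩ S₂` only. -/
lemma exists_inter_eq [Fintype α] {R : ℝ} {m : ℕ} (hm : 0 < m) (hR : 32 * m ≤ R)
    {S₁ S₂ : Finset α} {G₁ G₂ : Finset (Finset α)} (h₁ : IsSpreadOver R S₁ G₁)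
    (h₂ : IsSpreadOver R S₂ G₂) (hd₁ : ∀ A ∈ G₁, Disjoint A (S₂ \ S₁))
    (hd₂ : ∀ A ∈ G₂, Disjoint A (S₁ \ S₂)) (hc₁ : ∀ A ∈ G₁, #A < 2 ^ m)
    (hc₂ : ∀ A ∈ G₂, #A < 2 ^ m) : ∃ A ∈ G₁, ∃ B ∈ G₂, A ∩ B = S₁ ∩ S₂ := by
  have hR0 : 0 ≤ R := le_trans (by positivity) hR
  obtain ⟨A, hA, B, hB, hAB⟩ := exists_disjoint_of_spread hm hR G₁ h₁.nonempty (fun A => A \ S₁)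
    (fun A hA => (card_le_card sdiff_subset).trans_lt (hc₁ A hA))
    (h₁.card_filter_sdiff hR0) G₂ h₂.nonempty (fun B => B \ S₂)
    (fun B hB => (card_le_card sdiff_subset).trans_lt (hc₂ B hB)) (h₂.card_filter_sdiff hR0)
  refine ⟨A, hA, B, hB, subset_antisymm (fun x hx => ?_)
    (inter_subset_inter (h₁.subset A hA) (h₂.subset B hB))⟩
  rw [mem_inter] at hx ⊢
  have e1 := disjoint_left.1 (hd₁ A hA) hx.1
  have e2 := disjoint_left.1 (hd₂ B hB) hx.2
  have e3 : x ∈ A \ S₁ → x ∉ B \ S₂ := fun h => disjoint_left.1 hAB h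
  simp only [mem_sdiff, not_and, not_not] at e1 e2 e3
  by_cases hx1 : x ∈ S₁
  · exact ⟨hx1, e2 hx1⟩
  · exact absurd (e1 (e3 ⟨hx.1, hx1⟩ hx.2)) hx1

/-- The kernels of spread subfamilies of a `t`-intersecting family are `t`-intersecting. -/
lemma card_inter_of_isSpreadOver [Fintype α] {R : ℝ} {m k t : ℕ} (hm : 0 < m)
    (hR : 64 * m ≤ R) (hk : k < 2 ^ m) {F : Finset (Finset α)} (hF : ∀ A ∈ F, #A = k)
    (hint : ∀ A ∈ F, ∀ B ∈ F, t ≤ #(A ∩ B)) {S₁ S₂ : Finset α} {G₁ G₂ : Finset (Finset α)}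
    (hG₁ : G₁ ⊆ F) (hG₂ : G₂ ⊆ F) (h₁ : IsSpreadOver R S₁ G₁) (h₂ : IsSpreadOver R S₂ G₂)
    (hS₁ : 2 * (#S₁ : ℝ) ≤ R) (hS₂ : 2 * (#S₂ : ℝ) ≤ R) : t ≤ #(S₁ ∩ S₂) := by
  have hR0 : 0 ≤ R := le_trans (by positivity) hR
  have hcard : ∀ A ∈ F, #A < 2 ^ m := fun A hA => (hF A hA).trans_lt hk
  obtain ⟨A, hA, B, hB, hAB⟩ := exists_inter_eq hm (by linarith)
    (h₁.filter_disjoint hR0 hS₂) (h₂.filter_disjoint hR0 hS₁)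
    (fun A hA => (mem_filter.1 hA).2) (fun A hA => (mem_filter.1 hA).2)
    (fun A hA => hcard A (hG₁ (mem_filter.1 hA).1))
    (fun A hA => hcard A (hG₂ (mem_filter.1 hA).1))
  rw [← hAB]
  exact hint A (hG₁ (mem_filter.1 hA).1) B (hG₂ (mem_filter.1 hB).1)

end Spread

/-! ### Peeling off an intersecting family of small sets -/

section Peeling

variable {α : Type*} [DecidableEq α]

/-- The members of `U` of size `q` no proper subset of which belongs to `U`. -/
def minimalOfCard (U : Finset (Finset α)) (q : ℕ) : Finset (Finset α) :=
  {T ∈ U | #T = q ∧ ∀ X ∈ U, ¬ X ⊂ T}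

lemma mem_minimalOfCard {U : Finset (Finset α)} {q : ℕ} {T : Finset α} :
    T ∈ minimalOfCard U q ↔ T ∈ U ∧ #T = q ∧ ∀ X ∈ U, ¬ X ⊂ T :=
  mem_filter

/-- For `T ⊋ X` minimal, `X` meets some `Y ∈ U` in fewer than `t` elements, so `T` contains an
element of `Y \ X`, a set of size at most `2 * d`. Repeat with this element added to `X`. -/
lemma card_minimalOfCard_superset_le {t d : ℕ} {U : Finset (Finset α)}
    (hcard : ∀ S ∈ U, #S ≤ t + d) (hint : ∀ A ∈ U, ∀ B ∈ U, t ≤ #(A ∩ B))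
    (hmax : ∀ X, t ≤ #X → #X ≤ t + d → X ∉ U → ∃ Y ∈ U, #(X ∩ Y) < t) :
    ∀ (j : ℕ) (X : Finset α), t ≤ #X → #X + j = t + d →
      #{T ∈ minimalOfCard U (t + d) | X ⊆ T} ≤ (2 * d) ^ j := by
  intro j
  induction j with
  | zero =>
    intro X _ hX
    rw [pow_zero, card_le_one]
    have h : ∀ T ∈ {T ∈ minimalOfCard U (t + d) | X ⊆ T}, X = T := by
      intro T hT
      simp only [minimalOfCard, mem_filter] at hT
      exact eq_of_subset_of_card_le hT.2 (by omega)
    intro T hT T' hT'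
    rw [← h T hT, ← h T' hT']
  | succ j ih =>
    intro X htX hX
    rcases ({T ∈ minimalOfCard U (t + d) | X ⊆ T}).eq_empty_or_nonempty with h | ⟨T₀, hT₀⟩
    · rw [h, card_empty]
      exact Nat.zero_le _
    simp only [minimalOfCard, mem_filter] at hT₀
    obtain ⟨⟨hT₀U, hT₀c, hT₀m⟩, hXT₀⟩ := hT₀
    have hXU : X ∉ U := fun hXU => hT₀m X hXU (hXT₀.ssubset_of_ne fun h => by
      rw [h] at hX
      omega)
    obtain ⟨Y, hY, hXY⟩ := hmax X htX (by omega) hXU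
    have hYX : #(Y \ X) ≤ 2 * d := by
      have h1 := hint T₀ hT₀U Y hY
      have h2 : #(T₀ ∩ Y) ≤ #(X ∩ Y) + #(T₀ \ X) := by
        refine le_trans (card_le_card fun x hx => ?_) (card_union_le _ _)
        simp only [mem_inter, mem_union, mem_sdiff] at hx ⊢
        tauto
      have h3 := card_sdiff_add_card_eq_card hXT₀
      have h4 := hcard Y hY
      have h5 := card_sdiff_add_card_inter Y X
      rw [inter_comm] at h5
      omega
    calc #{T ∈ minimalOfCard U (t + d) | X ⊆ T}
        ≤ #((Y \ X).biUnion fun y => {T ∈ minimalOfCard U (t + d) | insert y X ⊆ T}) := by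
          refine card_le_card fun T hT => ?_
          rw [mem_filter] at hT
          obtain ⟨hT, hXT⟩ := hT
          have hTU := (mem_filter.1 hT).1
          have : ∃ y ∈ T ∩ Y, y ∉ X := by
            by_contra! h
            have h1 : T ∩ Y ⊆ X ∩ Y := fun y hy => mem_inter.2 ⟨h y hy, (mem_inter.1 hy).2⟩
            have h2 := card_le_card h1
            have h3 := hint T hTU Y hY
            omega
          obtain ⟨y, hy, hyX⟩ := this
          rw [mem_inter] at hy
          exact mem_biUnion.2 ⟨y, mem_sdiff.2 ⟨hy.2, hyX⟩,
            mem_filter.2 ⟨hT, insert_subset hy.1 hXT⟩⟩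
      _ ≤ ∑ y ∈ Y \ X, #{T ∈ minimalOfCard U (t + d) | insert y X ⊆ T} := card_biUnion_le
      _ ≤ ∑ y ∈ Y \ X, (2 * d) ^ j := by
          refine sum_le_sum fun y hy => ih (insert y X) ?_ ?_
          · exact htX.trans (card_le_card (subset_insert _ _))
          · rw [card_insert_of_notMem (mem_sdiff.1 hy).2]
            omega
      _ ≤ (2 * d) ^ (j + 1) := by
          rw [sum_const, smul_eq_mul, pow_succ, mul_comm]
          exact Nat.mul_le_mul_left _ hYX

/-- Each minimal set shares one of `(t + d).choose t` subsets of size `t` with a fixed one, and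
`(t + d).choose d * (2 * d) ^ d ≤ (2 * (t + d)) ^ d * (d ^ d / d!)`, where `d ^ d / d! ≤ exp d`. -/
lemma card_minimalOfCard_le {t d : ℕ} {U : Finset (Finset α)}
    (hcard : ∀ S ∈ U, #S ≤ t + d) (hint : ∀ A ∈ U, ∀ B ∈ U, t ≤ #(A ∩ B))
    (hmax : ∀ X, t ≤ #X → #X ≤ t + d → X ∉ U → ∃ Y ∈ U, #(X ∩ Y) < t) :
    (#(minimalOfCard U (t + d)) : ℝ) ≤ (6 * (t + d : ℕ)) ^ d := by
  rcases (minimalOfCard U (t + d)).eq_empty_or_nonempty with h | ⟨T₁, hT₁⟩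
  · rw [h, card_empty, Nat.cast_zero]
    positivity
  have hnat : #(minimalOfCard U (t + d)) ≤ (t + d).choose d * (2 * d) ^ d := by
    obtain ⟨hT₁U, hT₁c, -⟩ := mem_filter.1 hT₁
    calc #(minimalOfCard U (t + d))
        ≤ #((powersetCard t T₁).biUnion fun X => {T ∈ minimalOfCard U (t + d) | X ⊆ T}) := by
          refine card_le_card fun T hT => ?_
          obtain ⟨X, hX, hXc⟩ := exists_subset_card_eq (hint T (mem_filter.1 hT).1 T₁ hT₁U)
          exact mem_biUnion.2 ⟨X, mem_powersetCard.2 ⟨hX.trans inter_subset_right, hXc⟩,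
            mem_filter.2 ⟨hT, hX.trans inter_subset_left⟩⟩
      _ ≤ ∑ X ∈ powersetCard t T₁, #{T ∈ minimalOfCard U (t + d) | X ⊆ T} := card_biUnion_le
      _ ≤ ∑ X ∈ powersetCard t T₁, (2 * d) ^ d := by
          refine sum_le_sum fun X hX => ?_
          have hXc := (mem_powersetCard.1 hX).2
          exact card_minimalOfCard_superset_le hcard hint hmax d X hXc.ge (by omega)
      _ = (t + d).choose d * (2 * d) ^ d := by
          rw [sum_const, smul_eq_mul, card_powersetCard, hT₁c, Nat.choose_symm_add]
  calc (#(minimalOfCard U (t + d)) : ℝ) ≤ ((t + d).choose d : ℝ) * (2 * d) ^ d := by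
        exact_mod_cast hnat
    _ ≤ ((t + d : ℕ) : ℝ) ^ d / (d.factorial : ℝ) * (2 * d) ^ d := by
        gcongr
        exact Nat.choose_le_pow_div d (t + d)
    _ = ((t + d : ℕ) : ℝ) ^ d * 2 ^ d * ((d : ℝ) ^ d / (d.factorial : ℝ)) := by
        rw [mul_pow]
        ring
    _ ≤ ((t + d : ℕ) : ℝ) ^ d * 2 ^ d * 3 ^ d := by
        gcongr
        refine (Real.pow_div_factorial_le_exp d (Nat.cast_nonneg d) d).trans ?_
        rw [← mul_one (d : ℝ), Real.exp_nat_mul]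
        have := Real.exp_one_lt_d9
        gcongr
        linarith
    _ = (6 * (t + d : ℕ)) ^ d := by
        rw [← mul_pow, ← mul_pow]
        ring

/-- If the degrees in `𝒜` decay geometrically, then the members of `𝒜` that contain a set of a
`t`-intersecting family of small sets mostly contain one fixed `t`-set. The family is enlarged to
a maximal `t`-intersecting one, its minimal sets of the largest size are removed, and so on. -/
lemma exists_kernel [Fintype α] {𝒜 : Finset (Finset α)} {t : ℕ} {ρ M : ℝ} (hρ : 0 < ρ)
    (hM : ∀ S : Finset α, t ≤ #S → (#{A ∈ 𝒜 | S ⊆ A} : ℝ) * ρ ^ (#S - t) ≤ M)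
    (ht : ∃ T : Finset α, #T = t) {Q : ℝ} :
    ∀ (d : ℕ) (𝒮 : Finset (Finset α)), ((t + d : ℕ) : ℝ) ≤ Q → (∀ S ∈ 𝒮, #S ≤ t + d) →
      (∀ A ∈ 𝒮, ∀ B ∈ 𝒮, t ≤ #(A ∩ B)) →
      ∃ T₀ : Finset α, #T₀ = t ∧
        (#{A ∈ 𝒜 | (∃ S ∈ 𝒮, S ⊆ A) ∧ ¬ T₀ ⊆ A} : ℝ) ≤
          M * ∑ i ∈ range d, (6 * Q / ρ) ^ (i + 1) := by
  classical
  have hM0 : 0 ≤ M := by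
    obtain ⟨T, hT⟩ := ht
    have := hM T hT.ge
    rw [hT, Nat.sub_self, pow_zero, mul_one] at this
    exact (Nat.cast_nonneg _).trans this
  intro d
  induction d with
  | zero =>
    intro 𝒮 _ hcard hint
    rcases 𝒮.eq_empty_or_nonempty with rfl | ⟨S, hS⟩
    · obtain ⟨T, hT⟩ := ht
      exact ⟨T, hT, by simp⟩
    · have hSc : ∀ S ∈ 𝒮, #S = t := by
        intro S hS
        have h1 := hint S hS S hS
        rw [inter_self] at h1
        exact le_antisymm (hcard S hS) h1
      have hSS : ∀ S' ∈ 𝒮, S ⊆ S' := by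
        intro S' hS'
        have h1 := eq_of_subset_of_card_le (inter_subset_left (s₁ := S) (s₂ := S'))
          ((hSc S hS).trans_le (hint S hS S' hS'))
        rw [← h1]
        exact inter_subset_right
      refine ⟨S, hSc S hS, ?_⟩
      have : {A ∈ 𝒜 | (∃ S ∈ 𝒮, S ⊆ A) ∧ ¬ S ⊆ A} = ∅ := by
        refine filter_eq_empty_iff.2 fun A _ h => ?_
        obtain ⟨⟨S', hS', hA⟩, hSA⟩ := h
        exact hSA ((hSS S' hS').trans hA)
      rw [this]
      simp
  | succ d ih =>
    intro 𝒮 hQ hcard hint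
    obtain ⟨U, hSU, hU⟩ := exists_le_maximal
      {U : Finset (Finset α) | (∀ S ∈ U, #S ≤ t + (d + 1)) ∧ ∀ A ∈ U, ∀ B ∈ U, t ≤ #(A ∩ B)}
      (mem_filter.2 ⟨mem_univ 𝒮, hcard, hint⟩)
    obtain ⟨hUcard, hUint⟩ := (mem_filter.1 hU.1).2
    have hUmax : ∀ X, t ≤ #X → #X ≤ t + (d + 1) → X ∉ U → ∃ Y ∈ U, #(X ∩ Y) < t := by
      intro X htX hX hXU
      by_contra! h
      refine hXU (hU.2 (y := insert X U) (mem_filter.2 ⟨mem_univ _, ?_, ?_⟩)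
        (subset_insert _ _) (mem_insert_self _ _))
      · intro S hS
        rcases mem_insert.1 hS with rfl | hS
        exacts [hX, hUcard S hS]
      · intro A hA B hB
        rcases mem_insert.1 hA with hA | hA <;> rcases mem_insert.1 hB with hB | hB
        · rwa [hA, hB, inter_self]
        · rw [hA]
          exact h B hB
        · rw [hB, inter_comm]
          exact h A hA
        · exact hUint A hA B hB
    obtain ⟨T₀, hT₀, hle⟩ := ih {S ∈ U | #S ≤ t + d}
      (le_trans (by exact_mod_cast Nat.le_succ _) hQ) (fun S hS => (mem_filter.1 hS).2)
      (fun A hA B hB => hUint A (mem_filter.1 hA).1 B (mem_filter.1 hB).1)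
    refine ⟨T₀, hT₀, ?_⟩
    -- A member of `U` of the largest size is minimal or contains a smaller member of `U`.
    set W := minimalOfCard U (t + (d + 1)) with hW
    have hcover : {A ∈ 𝒜 | (∃ S ∈ 𝒮, S ⊆ A) ∧ ¬ T₀ ⊆ A} ⊆
        {A ∈ 𝒜 | (∃ S ∈ {S ∈ U | #S ≤ t + d}, S ⊆ A) ∧ ¬ T₀ ⊆ A} ∪
          W.biUnion fun T => {A ∈ 𝒜 | T ⊆ A} := by
      intro A hA
      obtain ⟨hA𝒜, ⟨S, hS, hSA⟩, hTA⟩ := mem_filter.1 hA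
      have hSU' : S ∈ U := hSU hS
      rw [mem_union]
      by_cases hSc : #S ≤ t + d
      · exact Or.inl (mem_filter.2 ⟨hA𝒜, ⟨S, mem_filter.2 ⟨hSU', hSc⟩, hSA⟩, hTA⟩)
      · have hSc' : #S = t + (d + 1) := by
          have := hUcard S hSU'
          omega
        by_cases hmin : ∀ X ∈ U, ¬ X ⊂ S
        · exact Or.inr (mem_biUnion.2
            ⟨S, mem_minimalOfCard.2 ⟨hSU', hSc', hmin⟩, mem_filter.2 ⟨hA𝒜, hSA⟩⟩)
        · push Not at hmin
          obtain ⟨X, hX, hXS⟩ := hmin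
          have := card_lt_card hXS
          exact Or.inl (mem_filter.2 ⟨hA𝒜, ⟨X, mem_filter.2 ⟨hX, by omega⟩,
            hXS.subset.trans hSA⟩, hTA⟩)
    have hWle : (#(W.biUnion fun T => {A ∈ 𝒜 | T ⊆ A}) : ℝ) ≤ M * (6 * Q / ρ) ^ (d + 1) := by
      calc (#(W.biUnion fun T => {A ∈ 𝒜 | T ⊆ A}) : ℝ)
          ≤ ∑ T ∈ W, (#{A ∈ 𝒜 | T ⊆ A} : ℝ) := by exact_mod_cast card_biUnion_le
        _ ≤ ∑ T ∈ W, M / ρ ^ (d + 1) := by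
            refine sum_le_sum fun T hT => ?_
            rw [le_div_iff₀ (by positivity)]
            have hTc := (mem_minimalOfCard.1 hT).2.1
            have := hM T (by omega)
            rwa [hTc, Nat.add_sub_cancel_left] at this
        _ = #W * (M / ρ ^ (d + 1)) := by rw [sum_const, nsmul_eq_mul]
        _ ≤ (6 * Q) ^ (d + 1) * (M / ρ ^ (d + 1)) := by
            gcongr
            refine (card_minimalOfCard_le hUcard hUint hUmax).trans ?_
            gcongr
        _ = M * (6 * Q / ρ) ^ (d + 1) := by rw [div_pow]; ring
    calc (#{A ∈ 𝒜 | (∃ S ∈ 𝒮, S ⊆ A) ∧ ¬ T₀ ⊆ A} : ℝ)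
        ≤ #{A ∈ 𝒜 | (∃ S ∈ {S ∈ U | #S ≤ t + d}, S ⊆ A) ∧ ¬ T₀ ⊆ A} +
          #(W.biUnion fun T => {A ∈ 𝒜 | T ⊆ A}) := by
          exact_mod_cast (card_le_card hcover).trans (card_union_le _ _)
      _ ≤ M * ∑ i ∈ range d, (6 * Q / ρ) ^ (i + 1) + M * (6 * Q / ρ) ^ (d + 1) :=
          add_le_add hle hWle
      _ = M * ∑ i ∈ range (d + 1), (6 * Q / ρ) ^ (i + 1) := by rw [sum_range_succ, mul_add]

end Peeling

/-! ### Degrees in the slices of a complex -/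

section Degree

variable {N : ℕ}

/-- The number of `k`-element members of `C` that contain `X` and avoid `V`. -/
def avoidDegree (C : Finset (Finset (Fin N))) (k : ℕ) (X V : Finset (Fin N)) : ℕ :=
  #{A ∈ C.slice k | X ⊆ A ∧ Disjoint A V}

lemma card_link (A : Finset (Finset (Fin N))) (T : Finset (Fin N)) :
    #(link A T) = #{F ∈ A | T ⊆ F} := by
  rw [link, star, card_image_of_injOn]
  intro F hF G hG h
  rw [mem_coe, mem_filter] at hF hG
  simp only at h
  rw [← sdiff_union_of_subset hF.2, ← sdiff_union_of_subset hG.2, h]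

lemma avoidDegree_empty (C : Finset (Finset (Fin N))) (k : ℕ) (X : Finset (Fin N)) :
    avoidDegree C k X ∅ = #{A ∈ C.slice k | X ⊆ A} := by
  simp [avoidDegree]

/-- Replacing `y` in a member `A` by one of the at least `n - k - #V` other elements of a maximal
member containing `A \ {y}` gives a member through `X` that avoids `V`, and each such member
arises at most `k` times. -/
lemma avoidDegree_insert_mul_le {C : Finset (Finset (Fin N))} {n k : ℕ} (hC : IsComplex C)
    (hrank : RankGE C n) {X V : Finset (Fin N)} {y : Fin N} (hy : y ∉ X) :
    avoidDegree C k (insert y X) V * (n - k - #V) ≤ avoidDegree C k X V * k := by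
  let r : Finset (Fin N) → Finset (Fin N) → Prop :=
    fun A B => ∃ z ∈ B, z ∉ A.erase y ∧ A.erase y = B.erase z
  classical
  refine card_mul_le_card_mul r (fun A hA => ?_) fun B hB => ?_
  · rw [mem_filter, mem_slice] at hA
    obtain ⟨⟨hAC, hAk⟩, hXA, hAV⟩ := hA
    have hyA : y ∈ A := hXA (mem_insert_self _ _)
    obtain ⟨D, hD, hDmax⟩ := exists_le_maximal C (hC.2 A hAC (A.erase y) (erase_subset _ _))
    have hDn := hrank D hDmax
    let Z := (D \ A.erase y) \ V
    have hZ : n - k - #V ≤ #Z := by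
      have h1 := le_card_sdiff (A.erase y) D
      have h2 := le_card_sdiff V (D \ A.erase y)
      have h3 := card_erase_le (s := A) (a := y)
      change _ ≤ #((D \ A.erase y) \ V)
      omega
    refine hZ.trans ?_
    have hZA : ∀ z ∈ Z, z ∈ D ∧ z ∉ A.erase y ∧ z ∉ V := by
      intro z hz
      simp only [Z, mem_sdiff] at hz
      exact ⟨hz.1.1, hz.1.2, hz.2⟩
    have hinj : Set.InjOn (fun z => insert z (A.erase y)) Z := by
      intro z hz z' hz' h
      have : z ∈ insert z' (A.erase y) := by
        rw [← show insert z (A.erase y) = insert z' (A.erase y) from h]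
        exact mem_insert_self _ _
      exact (mem_insert.1 this).resolve_right (hZA z hz).2.1
    rw [← card_image_of_injOn hinj]
    refine card_le_card fun B hB => ?_
    obtain ⟨z, hz, rfl⟩ := mem_image.1 hB
    obtain ⟨hzD, hzA, hzV⟩ := hZA z hz
    rw [mem_bipartiteAbove, mem_filter, mem_slice]
    refine ⟨⟨⟨hC.2 D hDmax.1 _ (insert_subset hzD hD), ?_⟩, ?_, ?_⟩, z, mem_insert_self _ _, hzA,
      (erase_insert hzA).symm⟩
    · rw [card_insert_of_notMem hzA, card_erase_of_mem hyA, hAk]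
      have : 0 < #A := card_pos.2 ⟨y, hyA⟩
      omega
    · exact (subset_erase.2 ⟨(subset_insert _ _).trans hXA, hy⟩).trans (subset_insert _ _)
    · rw [disjoint_insert_left]
      exact ⟨hzV, hAV.mono_left (erase_subset _ _)⟩
  · rw [mem_filter, mem_slice] at hB
    obtain ⟨⟨hBC, hBk⟩, -, -⟩ := hB
    rw [← hBk]
    refine (card_le_card (t := B.image fun z => insert y (B.erase z)) fun A hA => ?_).trans
      card_image_le
    rw [mem_bipartiteBelow, mem_filter] at hA
    obtain ⟨⟨-, hXA, -⟩, z, hz, -, h⟩ := hA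
    exact mem_image.2 ⟨z, hz, by rw [← h, insert_erase (hXA (mem_insert_self _ _))]⟩

lemma mul_avoidDegree_insert_le {C : Finset (Finset (Fin N))} {n k : ℕ} (hk : 0 < k)
    (hC : IsComplex C) (hrank : RankGE C n) {X V : Finset (Fin N)} (hV : #V ≤ k) {y : Fin N}
    (hy : y ∉ X) {ρ : ℝ} (hρ : ρ ≤ n / k - 2) :
    ρ * avoidDegree C k (insert y X) V ≤ avoidDegree C k X V := by
  have hk' : (0 : ℝ) < k := by exact_mod_cast hk
  have h1 : ρ * k ≤ ((n - k - #V : ℕ) : ℝ) := by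
    have h2 : ρ * k ≤ n - 2 * k := by
      calc ρ * k ≤ (n / k - 2) * k := mul_le_mul_of_nonneg_right hρ hk'.le
        _ = n - 2 * k := by field_simp
    have h3 : n ≤ (n - k - #V : ℕ) + k + k := by omega
    have h4 : (n : ℝ) ≤ ((n - k - #V : ℕ) : ℝ) + k + k := by exact_mod_cast h3
    linarith
  have h2 : (avoidDegree C k (insert y X) V : ℝ) * ((n - k - #V : ℕ) : ℝ) ≤
      avoidDegree C k X V * k := by
    exact_mod_cast avoidDegree_insert_mul_le hC hrank hy
  have h3 : (0 : ℝ) ≤ avoidDegree C k (insert y X) V := Nat.cast_nonneg _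
  refine le_of_mul_le_mul_right ?_ hk'
  nlinarith

/-- The slices of a complex of large rank are spread. -/
lemma avoidDegree_mul_pow_le {C : Finset (Finset (Fin N))} {n k : ℕ} (hk : 0 < k)
    (hC : IsComplex C) (hrank : RankGE C n) {V : Finset (Fin N)} (hV : #V ≤ k) {ρ : ℝ}
    (hρ0 : 0 ≤ ρ) (hρ : ρ ≤ n / k - 2) {X Y : Finset (Fin N)} (hXY : X ⊆ Y) :
    (avoidDegree C k Y V : ℝ) * ρ ^ #(Y \ X) ≤ avoidDegree C k X V := by
  have key : ∀ Z : Finset (Fin N), Disjoint X Z →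
      (avoidDegree C k (X ∪ Z) V : ℝ) * ρ ^ #Z ≤ avoidDegree C k X V := by
    intro Z
    induction Z using Finset.induction_on with
    | empty => simp
    | insert y Z hy ih =>
      intro hd
      rw [disjoint_insert_right] at hd
      have h1 := mul_avoidDegree_insert_le hk hC hrank hV (X := X ∪ Z) (y := y)
        (by simp [hd.1, hy]) hρ
      rw [union_insert, card_insert_of_notMem hy, pow_succ]
      calc _ = (ρ * avoidDegree C k (insert y (X ∪ Z)) V) * ρ ^ #Z := by ring
        _ ≤ avoidDegree C k (X ∪ Z) V * ρ ^ #Z := by gcongr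
        _ ≤ _ := ih hd.2
  have := key (Y \ X) disjoint_sdiff
  rwa [union_sdiff_of_subset hXY] at this

/-- Each element that has to be avoided costs a factor of `1 - 1 / ρ` only. -/
lemma pow_mul_avoidDegree_le {C : Finset (Finset (Fin N))} {n k : ℕ} (hk : 0 < k)
    (hC : IsComplex C) (hrank : RankGE C n) {ρ : ℝ} (hρ1 : 1 ≤ ρ) (hρ : ρ ≤ n / k - 2)
    {X : Finset (Fin N)} (V : Finset (Fin N)) (hXV : Disjoint X V) (hV : #V ≤ k) :
    (1 - 1 / ρ) ^ #V * avoidDegree C k X ∅ ≤ avoidDegree C k X V := by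
  have hρ0 : 0 < ρ := by linarith
  have hc : 0 ≤ 1 - 1 / ρ := sub_nonneg.2 ((div_le_one hρ0).2 hρ1)
  induction V using Finset.induction_on with
  | empty => simp
  | insert v V hv ih =>
    rw [disjoint_insert_right] at hXV
    rw [card_insert_of_notMem hv] at hV ⊢
    have h1 := mul_avoidDegree_insert_le hk hC hrank (V := V) (by omega) hXV.1 hρ
    have h2 : avoidDegree C k X V ≤
        avoidDegree C k X (insert v V) + avoidDegree C k (insert v X) V := by
      refine le_trans (card_le_card fun A hA => ?_) (card_union_le _ _)
      simp only [mem_union, mem_filter, disjoint_insert_right, insert_subset_iff] at hA ⊢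
      tauto
    have h2' : (avoidDegree C k X V : ℝ) ≤
        avoidDegree C k X (insert v V) + avoidDegree C k (insert v X) V := by exact_mod_cast h2
    have h3 : (avoidDegree C k (insert v X) V : ℝ) ≤ 1 / ρ * avoidDegree C k X V := by
      rw [one_div, le_inv_mul_iff₀ hρ0]
      exact h1
    have h4 := mul_le_mul_of_nonneg_left (ih hXV.2 (by omega)) hc
    rw [pow_succ]
    calc _ = (1 - 1 / ρ) * ((1 - 1 / ρ) ^ #V * avoidDegree C k X ∅) := by ring
      _ ≤ _ := h4
      _ ≤ _ := by linarith

end Degree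

/-! ### Intersecting families in a slice of a complex -/

section Slice

variable {N : ℕ} {C F : Finset (Finset (Fin N))} {n k t m : ℕ} {ρ M : ℝ}

lemma avoidDegree_mul_pow_le_max (hk : 0 < k) (hC : IsComplex C) (hrank : RankGE C n)
    (hρ0 : 0 ≤ ρ) (hρ : ρ ≤ n / k - 2)
    (hM : ∀ T : Finset (Fin N), #T = t → (avoidDegree C k T ∅ : ℝ) ≤ M) (S : Finset (Fin N))
    (hS : t ≤ #S) : (avoidDegree C k S ∅ : ℝ) * ρ ^ (#S - t) ≤ M := by
  obtain ⟨T, hTS, hT⟩ := exists_subset_card_eq hS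
  have h := avoidDegree_mul_pow_le hk hC hrank (V := ∅) (by simp) hρ0 hρ hTS
  rw [card_sdiff_of_subset hTS, hT] at h
  exact h.trans (hM T hT)

/-- A family in the slice that has a large share of its members through a big set `S` is small,
since the slice itself has few members through `S`. -/
lemma card_mul_two_pow_le (hk : 0 < k) (hC : IsComplex C) (hrank : RankGE C n)
    (hρ0 : 0 < ρ) (hρ : ρ ≤ n / k - 2)
    (hM : ∀ T : Finset (Fin N), #T = t → (avoidDegree C k T ∅ : ℝ) ≤ M)
    {H : Finset (Finset (Fin N))} (hH : H ⊆ C.slice k) {S : Finset (Fin N)} (hS : t ≤ #S)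
    (hHS : (#H : ℝ) ≤ (ρ / 2) ^ #S * #{A ∈ H | S ⊆ A}) : (#H : ℝ) * 2 ^ #S ≤ ρ ^ t * M := by
  have h1 : (#{A ∈ H | S ⊆ A} : ℝ) ≤ avoidDegree C k S ∅ := by
    rw [avoidDegree_empty]
    exact_mod_cast card_le_card (filter_subset_filter _ hH)
  have h2 := avoidDegree_mul_pow_le_max hk hC hrank hρ0.le hρ hM S hS
  calc (#H : ℝ) * 2 ^ #S ≤ ((ρ / 2) ^ #S * #{A ∈ H | S ⊆ A}) * 2 ^ #S := by gcongr
    _ = ρ ^ #S * #{A ∈ H | S ⊆ A} := by rw [div_pow]; field_simp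
    _ ≤ ρ ^ #S * avoidDegree C k S ∅ := by gcongr
    _ = ρ ^ t * (avoidDegree C k S ∅ * ρ ^ (#S - t)) := by
      rw [← Nat.add_sub_cancel' hS, pow_add, Nat.add_sub_cancel_left]
      ring
    _ ≤ ρ ^ t * M := by gcongr

/-- All but few members of a `t`-intersecting family in the slice contain one fixed `t`-set. The
sets of size at most `t + d` over which some subfamily is spread form a `t`-intersecting family to
which `exists_kernel` applies, and few members of `F` contain none of them. -/
lemma exists_card_not_subset_le (hk : 0 < k) (hC : IsComplex C) (hrank : RankGE C n)
    (hρ : ρ ≤ n / k - 2)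
    (hM : ∀ T : Finset (Fin N), #T = t → (avoidDegree C k T ∅ : ℝ) ≤ M)
    (hT : ∃ T : Finset (Fin N), #T = t) (hF : F ⊆ C.slice k) (hint : IsTIntersecting t F)
    (hm : 0 < m) (hmρ : 128 * m ≤ ρ) (hkm : k < 2 ^ m) {d : ℕ} {Q : ℝ}
    (hQ : ((t + d : ℕ) : ℝ) ≤ Q) (hQρ : 6000 * Q ≤ ρ) (hd : 1000 * ρ ^ t ≤ 2 ^ (t + d)) :
    ∃ T₀ : Finset (Fin N), #T₀ = t ∧ (#{A ∈ F | ¬ T₀ ⊆ A} : ℝ) ≤ M / 100 := by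
  classical
  have hm1 : (1 : ℝ) ≤ m := by exact_mod_cast hm
  have hρ0 : 0 < ρ := by linarith
  have hQ0 : 0 ≤ Q := (Nat.cast_nonneg _).trans hQ
  have hM0 : 0 ≤ M := by
    obtain ⟨T, hT⟩ := hT
    exact (Nat.cast_nonneg _).trans (hM T hT)
  have hFk : ∀ A ∈ F, #A = k := fun A hA => (mem_slice.1 (hF hA)).2
  set 𝒮 : Finset (Finset (Fin N)) := {S | #S ≤ t + d ∧ ∃ G ⊆ F, IsSpreadOver (ρ / 2) S G} with h𝒮
  have hmem : ∀ S, S ∈ 𝒮 ↔ #S ≤ t + d ∧ ∃ G ⊆ F, IsSpreadOver (ρ / 2) S G := by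
    simp [h𝒮]
  have hsmall : ∀ S ∈ 𝒮, 2 * (#S : ℝ) ≤ ρ / 2 := by
    intro S hS
    have h1 : (#S : ℝ) ≤ ((t + d : ℕ) : ℝ) := by exact_mod_cast ((hmem S).1 hS).1
    linarith
  have h𝒮int : ∀ S₁ ∈ 𝒮, ∀ S₂ ∈ 𝒮, t ≤ #(S₁ ∩ S₂) := by
    intro S₁ hS₁ S₂ hS₂
    obtain ⟨-, G₁, hG₁, h₁⟩ := (hmem S₁).1 hS₁
    obtain ⟨-, G₂, hG₂, h₂⟩ := (hmem S₂).1 hS₂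
    exact card_inter_of_isSpreadOver hm (by linarith) hkm hFk hint hG₁ hG₂ h₁ h₂
      (hsmall S₁ hS₁) (hsmall S₂ hS₂)
  have hrest : (#{A ∈ F | ¬ ∃ S ∈ 𝒮, S ⊆ A} : ℝ) ≤ M / 1000 := by
    set F' := {A ∈ F | ¬ ∃ S ∈ 𝒮, S ⊆ A} with hF'
    rcases F'.eq_empty_or_nonempty with h | h
    · rw [h, card_empty, Nat.cast_zero]
      positivity
    -- A link of the rest is spread over some `S`, which is not small as it is not in `𝒮`.
    obtain ⟨S, hS, hSp⟩ := exists_isSpreadOver (half_pos hρ0) h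
    have hSq : t + d < #S := by
      by_contra! hle
      have hS𝒮 : S ∈ 𝒮 := (hmem S).2 ⟨hle, _, (filter_subset _ _).trans (filter_subset _ _), hSp⟩
      obtain ⟨A, hA⟩ := hSp.nonempty
      obtain ⟨hAF', hSA⟩ := mem_filter.1 hA
      exact (mem_filter.1 hAF').2 ⟨S, hS𝒮, hSA⟩
    have h1 := card_mul_two_pow_le hk hC hrank hρ0 hρ hM ((filter_subset _ _).trans hF)
      (by omega) hS
    have h2 : (1000 : ℝ) * ρ ^ t ≤ 2 ^ #S :=
      hd.trans (pow_le_pow_right₀ (by norm_num) hSq.le)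
    have h3 : (0 : ℝ) ≤ #F' := Nat.cast_nonneg _
    have h4 : 0 < ρ ^ t := by positivity
    have h5 : (#F' * 1000 : ℝ) * ρ ^ t ≤ M * ρ ^ t := by nlinarith
    have h6 := le_of_mul_le_mul_right h5 h4
    linarith
  obtain ⟨T₀, hT₀, hker⟩ := exists_kernel (𝒜 := C.slice k) hρ0 (fun S hS => by
    rw [← avoidDegree_empty]
    exact avoidDegree_mul_pow_le_max hk hC hrank hρ0.le hρ hM S hS) hT d 𝒮 hQ
    (fun S hS => ((hmem S).1 hS).1) h𝒮int
  refine ⟨T₀, hT₀, ?_⟩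
  set y := 6 * Q / ρ with hy
  have hy0 : 0 ≤ y := by positivity
  have hy1 : y ≤ 1 / 1000 := by
    rw [hy, div_le_iff₀ hρ0]
    linarith
  have hgeom : ∑ i ∈ range d, y ^ (i + 1) ≤ 2 * y := by
    have h1 : ∑ i ∈ range d, y ^ (i + 1) = (∑ i ∈ range d, y ^ i) * y := by
      rw [sum_mul]
      exact sum_congr rfl fun i _ => pow_succ _ _
    have h2 := geom_sum_mul_neg y d
    have h3 : 0 ≤ y ^ d := by positivity
    have h4 : 0 ≤ ∑ i ∈ range d, y ^ i := sum_nonneg fun i _ => by positivity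
    rw [h1]
    exact mul_le_mul_of_nonneg_right (by nlinarith) hy0
  have hker' : (#{A ∈ C.slice k | (∃ S ∈ 𝒮, S ⊆ A) ∧ ¬ T₀ ⊆ A} : ℝ) ≤ M * (1 / 500) :=
    hker.trans (mul_le_mul_of_nonneg_left (by linarith) hM0)
  have hcover : {A ∈ F | ¬ T₀ ⊆ A} ⊆ {A ∈ F | ¬ ∃ S ∈ 𝒮, S ⊆ A} ∪
      {A ∈ C.slice k | (∃ S ∈ 𝒮, S ⊆ A) ∧ ¬ T₀ ⊆ A} := by
    intro A hA
    obtain ⟨hAF, hTA⟩ := mem_filter.1 hA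
    rw [mem_union, mem_filter, mem_filter]
    by_cases h : ∃ S ∈ 𝒮, S ⊆ A
    · exact Or.inr ⟨hF hAF, h, hTA⟩
    · exact Or.inl ⟨hAF, h⟩
  have hle : (#{A ∈ F | ¬ T₀ ⊆ A} : ℝ) ≤ #{A ∈ F | ¬ ∃ S ∈ 𝒮, S ⊆ A} +
      #{A ∈ C.slice k | (∃ S ∈ 𝒮, S ⊆ A) ∧ ¬ T₀ ⊆ A} := by
    exact_mod_cast (card_le_card hcover).trans (card_union_le _ _)
  linarith

/-- Stability: if `F` contains most of the sets through `T₀`, then each member of `F` outside the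
star of `T₀` costs many members of the star. Indeed, choose `S` such that the members outside that
contain `S` are many and spread over `S`.
If `F` contained at least half of the sets through `T₀` that avoid `S \ T₀`, then there would be
members of both kinds intersecting in `T₀ ∩ S` only. Avoiding `S \ T₀` costs a factor close to
`1` per element, whereas the number of members outside decays like `2 ^ (-#S)`. -/
lemma card_not_subset_mul_add_le (hk : 0 < k) (hC : IsComplex C) (hrank : RankGE C n)
    (hρ : ρ ≤ n / k - 2)
    (hM : ∀ T : Finset (Fin N), #T = t → (avoidDegree C k T ∅ : ℝ) ≤ M) (hM0 : 0 < M)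
    (hF : F ⊆ C.slice k) (hint : IsTIntersecting t F)
    (hm : 0 < m) (hmρ : 128 * m ≤ ρ) (hkm : k < 2 ^ m) (htρ : 8 * t ≤ ρ) {E : ℝ} (hE0 : 0 ≤ E)
    (hE : ∀ s : ℕ, 0.18 * ρ ≤ s → 8 * ((1 + E) * ρ ^ t) ≤ (3 / 2) ^ s)
    {T₀ : Finset (Fin N)} (hT₀ : #T₀ = t) (hlarge : 0.59 * M ≤ #{A ∈ F | T₀ ⊆ A})
    (hH : {A ∈ F | ¬ T₀ ⊆ A}.Nonempty) :
    (#{A ∈ F | ¬ T₀ ⊆ A} : ℝ) * (1 + E) + #{A ∈ F | T₀ ⊆ A} ≤ M := by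
  classical
  have hm1 : (1 : ℝ) ≤ m := by exact_mod_cast hm
  have hρ0 : 0 < ρ := by linarith
  set H := {A ∈ F | ¬ T₀ ⊆ A} with hHdef
  set F₀ := {A ∈ F | T₀ ⊆ A} with hF₀def
  have hFk : ∀ A ∈ F, #A = k := fun A hA => (mem_slice.1 (hF hA)).2
  have hHF : ∀ A ∈ H, A ∈ F := fun A hA => (mem_filter.1 hA).1
  have hF₀F : ∀ A ∈ F₀, A ∈ F := fun A hA => (mem_filter.1 hA).1
  obtain ⟨S, hS, hSp⟩ := exists_isSpreadOver (half_pos hρ0) hH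
  have hSk : #S ≤ k := by
    obtain ⟨A, hA⟩ := hSp.nonempty
    obtain ⟨hAH, hSA⟩ := mem_filter.1 hA
    rw [← hFk A (hHF A hAH)]
    exact card_le_card hSA
  set V := S \ T₀ with hV
  have hVS : #V ≤ #S := card_le_card sdiff_subset
  set a₀ : ℝ := (avoidDegree C k T₀ ∅ : ℝ) with ha₀
  set a : ℝ := (avoidDegree C k T₀ V : ℝ) with ha
  have ha₀M : a₀ ≤ M := hM T₀ hT₀
  have hF₀a₀ : (#F₀ : ℝ) ≤ a₀ := by
    rw [ha₀, avoidDegree_empty]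
    exact_mod_cast card_le_card (filter_subset_filter _ hF)
  have ha₀pos : 0 < a₀ := by linarith
  set c := 1 - 1 / ρ with hc
  have hρinv : 1 / ρ ≤ 1 / 128 := one_div_le_one_div_of_le (by norm_num) (by linarith)
  have hρinv0 : 0 < 1 / ρ := by positivity
  have hc0 : 3 / 4 ≤ c := by linarith
  have hc1 : c ≤ 1 := by linarith
  have hcs : c ^ #S * a₀ ≤ a := by
    refine le_trans ?_ (pow_mul_avoidDegree_le hk hC hrank (by linarith) hρ V disjoint_sdiff
      (hVS.trans hSk))
    exact mul_le_mul_of_nonneg_right (pow_le_pow_of_le_one (by linarith) hc1 hVS) ha₀pos.le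
  have hapos : 0 < a := lt_of_lt_of_le (mul_pos (pow_pos (by linarith) _) ha₀pos) hcs
  set G := {A ∈ F₀ | Disjoint A V} with hG
  have hGa : 2 * (#G : ℝ) < a := by
    by_contra! hle
    have hGpos : G.Nonempty := by
      rw [← card_pos]
      have : (0 : ℝ) < #G := by linarith
      exact_mod_cast this
    have hGsp : IsSpreadOver (ρ / 2) T₀ G := by
      refine isSpreadOver_half hGpos
        (fun A hA => (mem_filter.1 (mem_filter.1 hA).1).2) hle fun X hX => ?_
      refine le_trans (mul_le_mul_of_nonneg_right ?_ (by positivity))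
        (avoidDegree_mul_pow_le hk hC hrank (hVS.trans hSk) hρ0.le hρ hX)
      exact_mod_cast card_le_card fun A hA => by
        obtain ⟨hAG, hXA⟩ := mem_filter.1 hA
        obtain ⟨hAF, hAV⟩ := mem_filter.1 hAG
        exact mem_filter.2 ⟨hF (hF₀F A hAF), hXA, hAV⟩
    obtain ⟨A, hA, B, hB, hAB⟩ := exists_inter_eq hm (R := ρ / 2 / 2) (by linarith)
      (hGsp.mono (by linarith) (by linarith))
      (hSp.filter_disjoint (T := T₀) (by linarith) (by rw [hT₀]; linarith))
      (fun A hA => (mem_filter.1 hA).2) (fun A hA => (mem_filter.1 hA).2)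
      (fun A hA => (hFk A (hF₀F A (mem_filter.1 hA).1)).trans_lt hkm)
      (fun A hA => (hFk A (hHF A (mem_filter.1 (mem_filter.1 hA).1).1)).trans_lt hkm)
    obtain ⟨hBH, hSB⟩ := mem_filter.1 (mem_filter.1 hB).1
    have h1 := hint A (hF₀F A (mem_filter.1 hA).1) B (hHF B hBH)
    rw [hAB] at h1
    have h2 := eq_of_subset_of_card_le (inter_subset_left (s₁ := T₀) (s₂ := S)) (hT₀.trans_le h1)
    exact (mem_filter.1 hBH).2 ((inter_eq_left.1 h2).trans hSB)
  -- More than half of the sets through `T₀` that avoid `V` are missing from `F`.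
  have hmiss : #F₀ + a ≤ a₀ + #G := by
    have h1 : #F₀ + avoidDegree C k T₀ V ≤ avoidDegree C k T₀ ∅ + #G := by
      have h2 : F₀ ∪ {A ∈ C.slice k | T₀ ⊆ A ∧ Disjoint A V} ⊆ {A ∈ C.slice k | T₀ ⊆ A} := by
        intro A hA
        rcases mem_union.1 hA with hA | hA
        · exact mem_filter.2 ⟨hF (hF₀F A hA), (mem_filter.1 hA).2⟩
        · exact mem_filter.2 ⟨(mem_filter.1 hA).1, (mem_filter.1 hA).2.1⟩
      have h3 : F₀ ∩ {A ∈ C.slice k | T₀ ⊆ A ∧ Disjoint A V} ⊆ G := by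
        intro A hA
        rw [mem_inter] at hA
        exact mem_filter.2 ⟨hA.1, (mem_filter.1 hA.2).2.2⟩
      have h4 := card_union_add_card_inter F₀ {A ∈ C.slice k | T₀ ⊆ A ∧ Disjoint A V}
      have h5 := card_le_card h2
      have h6 := card_le_card h3
      rw [avoidDegree_empty, avoidDegree]
      omega
    rw [ha, ha₀]
    exact_mod_cast h1
  have hgap : c ^ #S * a₀ / 2 ≤ a₀ - #F₀ := by linarith
  -- `F` misses at most `0.41 * a₀` sets through `T₀`, so Bernoulli's inequality bounds `#S` below.
  have hs : 0.18 * ρ ≤ #S := by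
    have h1 : c ^ #S ≤ 0.82 := by
      have h2 : c ^ #S * a₀ ≤ 0.82 * a₀ := by linarith
      exact le_of_mul_le_mul_right h2 ha₀pos
    have h2 := one_add_mul_le_pow (a := -(1 / ρ)) (by linarith) #S
    rw [← sub_eq_add_neg, ← hc] at h2
    have h3 : (0.18 : ℝ) ≤ #S * (1 / ρ) := by linarith
    rwa [mul_one_div, le_div_iff₀ hρ0] at h3
  have htS : t ≤ #S := by
    have : (t : ℝ) ≤ #S := by linarith
    exact_mod_cast this
  have hHle := card_mul_two_pow_le hk hC hrank hρ0 hρ hM ((filter_subset _ _).trans hF) htS hS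
  have hpow : (3 / 2 : ℝ) ^ #S ≤ 2 ^ #S * c ^ #S := by
    rw [← mul_pow]
    exact pow_le_pow_left₀ (by norm_num) (by linarith) _
  have h2s : (0 : ℝ) < 2 ^ #S := by positivity
  have hfinal : (#H * (1 + E)) * 2 ^ #S ≤ (a₀ - #F₀) * 2 ^ #S := by
    have hcpos : 0 < c ^ #S := pow_pos (by linarith) _
    calc (#H * (1 + E)) * 2 ^ #S = (#H * 2 ^ #S) * (1 + E) := by ring
      _ ≤ (ρ ^ t * M) * (1 + E) := by gcongr
      _ = 8 * ((1 + E) * ρ ^ t) * (M / 8) := by ring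
      _ ≤ (2 ^ #S * c ^ #S) * (M / 8) :=
        mul_le_mul_of_nonneg_right ((hE _ hs).trans hpow) (by linarith)
      _ ≤ (2 ^ #S * c ^ #S) * (a₀ / 2) :=
        mul_le_mul_of_nonneg_left (by linarith) (by positivity)
      _ = (c ^ #S * a₀ / 2) * 2 ^ #S := by ring
      _ ≤ (a₀ - #F₀) * 2 ^ #S := by gcongr
  have := le_of_mul_le_mul_right hfinal h2s
  linarith

end Slice

/-! ### Choice of parameters -/

section Parameters

variable {n k t : ℕ}

lemma two_pow_mul_log_le (hk : 0 < k)
    (h1 : (n : ℝ) ≥ 2 ^ 13 * (k : ℝ) * Real.logb 2 (2 * (k : ℝ))) :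
    2 ^ 13 * ((Nat.log 2 k + 1 : ℕ) : ℝ) ≤ (n : ℝ) / k := by
  have hk' : (0 : ℝ) < k := by exact_mod_cast hk
  have h2 : ((Nat.log 2 k + 1 : ℕ) : ℝ) ≤ Real.logb 2 (2 * k) := by
    rw [Real.le_logb_iff_rpow_le (by norm_num) (by positivity), Real.rpow_natCast, pow_succ,
      mul_comm]
    have : (2 : ℝ) ^ Nat.log 2 k ≤ k := by exact_mod_cast Nat.pow_log_le_self 2 hk.ne'
    linarith
  rw [le_div_iff₀ hk']
  nlinarith

lemma two_pow_mul_logb_sq_le (hk : 0 < k)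
    (h2 : (n : ℝ) ≥ 2 ^ 19 * (t : ℝ) * (k : ℝ) * (Real.logb 2 ((n : ℝ) / (k : ℝ))) ^ 2) :
    2 ^ 19 * (t * Real.logb 2 ((n : ℝ) / k) ^ 2) ≤ (n : ℝ) / k := by
  have hk' : (0 : ℝ) < k := by exact_mod_cast hk
  rw [le_div_iff₀ hk']
  linarith

lemma thirteen_le_logb {x : ℝ} (hx : 2 ^ 13 ≤ x) : 13 ≤ Real.logb 2 x := by
  rw [Real.le_logb_iff_rpow_le (by norm_num) (by linarith [show (0 : ℝ) < 2 ^ 13 by norm_num])]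
  norm_num at hx ⊢
  exact hx

/-- With `L = logb 2 x` we have `x ^ t = 2 ^ (t * L)`, and both `t * L` and `x / L` are small
compared to `x`. -/
lemma stability_parameter {x : ℝ} (hx : 2 ^ 13 ≤ x) (ht : 0 < t)
    (h : 2 ^ 19 * (t * Real.logb 2 x ^ 2) ≤ x) (s : ℕ) (hs : 0.18 * (x - 2) ≤ s) :
    8 * ((1 + (2 : ℝ) ^ ((2 : ℝ) ^ (-20 : ℤ) * (x / Real.logb 2 x))) * (x - 2) ^ t) ≤
      (3 / 2) ^ s := by
  have hL := thirteen_le_logb hx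
  have ht1 : (1 : ℝ) ≤ t := by exact_mod_cast ht
  norm_num at hx
  set L := Real.logb 2 x with hLdef
  have hx0 : 0 < x := by linarith
  set e : ℝ := (2 : ℝ) ^ (-20 : ℤ) * (x / L) with he
  have he0 : 0 ≤ e := by positivity
  have hex : e ≤ x / 1000 := by
    have h1 : x / L ≤ x := div_le_self hx0.le (by linarith)
    have h2 : (2 : ℝ) ^ (-20 : ℤ) ≤ 1 / 1000 := by norm_num
    calc e ≤ 1 / 1000 * x := mul_le_mul h2 h1 (by positivity) (by norm_num)
      _ = x / 1000 := by ring
  have htL : t * L ≤ x / 1000 := by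
    nlinarith [mul_pos (by linarith : (0 : ℝ) < t) (by linarith : 0 < L)]
  have hE1 : (1 : ℝ) ≤ 2 ^ e := Real.one_le_rpow (by norm_num) he0
  have hxt : (x - 2) ^ t ≤ (2 : ℝ) ^ (t * L) := by
    calc (x - 2) ^ t ≤ x ^ t := pow_le_pow_left₀ (by linarith) (by linarith) _
      _ = (2 : ℝ) ^ (t * L) := by
        rw [mul_comm, Real.rpow_mul_natCast (by norm_num), hLdef,
          Real.rpow_logb (by norm_num) (by norm_num) hx0]
  have hsq : (2 : ℝ) ^ ((s : ℝ) / 2) ≤ (3 / 2) ^ s := by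
    rw [show (s : ℝ) / 2 = 1 / 2 * s by ring, Real.rpow_mul_natCast (by norm_num),
      ← Real.sqrt_eq_rpow]
    refine pow_le_pow_left₀ (Real.sqrt_nonneg _) ?_ _
    rw [Real.sqrt_le_left (by norm_num)]
    norm_num
  calc 8 * ((1 + (2 : ℝ) ^ e) * (x - 2) ^ t)
      ≤ 8 * ((2 * (2 : ℝ) ^ e) * (2 : ℝ) ^ (t * L)) := by
        have : 0 ≤ (x - 2) ^ t := pow_nonneg (by linarith) _
        gcongr
        linarith
    _ = (2 : ℝ) ^ (4 + e + t * L) := by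
        rw [Real.rpow_add (by norm_num), Real.rpow_add (by norm_num)]
        norm_num
        ring
    _ ≤ (2 : ℝ) ^ ((s : ℝ) / 2) := by
        apply Real.rpow_le_rpow_of_exponent_le (by norm_num)
        linarith
    _ ≤ (3 / 2) ^ s := hsq

/-- A size threshold `t + d` for the kernels: large enough to absorb the factor `x ^ t`, but
small compared to `x`. -/
lemma exists_kernel_size {x : ℝ} (hx : 2 ^ 13 ≤ x) (ht : 0 < t)
    (h : 2 ^ 19 * (t * Real.logb 2 x ^ 2) ≤ x) :
    ∃ d : ℕ, 6000 * ((t + d : ℕ) : ℝ) ≤ x - 2 ∧ 1000 * (x - 2) ^ t ≤ 2 ^ (t + d) := by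
  have hL := thirteen_le_logb hx
  have ht1 : (1 : ℝ) ≤ t := by exact_mod_cast ht
  norm_num at hx
  set L := Real.logb 2 x with hLdef
  have hx0 : 0 < x := by linarith
  have hle : t * L ≤ ⌈t * L⌉₊ := Nat.le_ceil _
  have hlt : (⌈t * L⌉₊ : ℝ) < t * L + 1 := Nat.ceil_lt_add_one (by positivity)
  have htL : t ≤ ⌈t * L⌉₊ := by
    have : (t : ℝ) ≤ ⌈t * L⌉₊ := by nlinarith
    exact_mod_cast this
  refine ⟨⌈t * L⌉₊ + 10 - t, ?_, ?_⟩
  · rw [show t + (⌈t * L⌉₊ + 10 - t) = ⌈t * L⌉₊ + 10 by omega]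
    push_cast
    nlinarith
  · rw [show t + (⌈t * L⌉₊ + 10 - t) = ⌈t * L⌉₊ + 10 by omega]
    have hxt : (x - 2) ^ t ≤ (2 : ℝ) ^ ⌈t * L⌉₊ := by
      calc (x - 2) ^ t ≤ x ^ t := pow_le_pow_left₀ (by linarith) (by linarith) _
        _ = (2 : ℝ) ^ (t * L) := by
          rw [mul_comm, Real.rpow_mul_natCast (by norm_num), hLdef,
            Real.rpow_logb (by norm_num) (by norm_num) hx0]
        _ ≤ (2 : ℝ) ^ (⌈t * L⌉₊ : ℝ) := Real.rpow_le_rpow_of_exponent_le (by norm_num) hle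
        _ = _ := Real.rpow_natCast _ _
    have h0 : (0 : ℝ) ≤ (2 : ℝ) ^ ⌈t * L⌉₊ := by positivity
    rw [pow_add]
    linarith

end Parameters

lemma card_le_max_of_isTIntersecting {N n k t M m : ℕ} (hk : 0 < k) (ht : 0 < t)
    (h1 : (n : ℝ) ≥ 2 ^ 13 * (k : ℝ) * Real.logb 2 (2 * (k : ℝ)))
    (h2 : (n : ℝ) ≥ 2 ^ 19 * (t : ℝ) * (k : ℝ) * (Real.logb 2 ((n : ℝ) / (k : ℝ))) ^ 2)
    {C : Finset (Finset (Fin N))} (hC : IsComplex C) (hrank : RankGE C n)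
    {F : Finset (Finset (Fin N))} (hF : F ⊆ C.slice k) (hint : IsTIntersecting t F)
    (hM : ∀ T : Finset (Fin N), #T = t → #{A ∈ C.slice k | T ⊆ A} ≤ M)
    (hm : ∀ T : Finset (Fin N), #T = t → m ≤ #{A ∈ F | ¬ T ⊆ A}) :
    (#F : ℝ) ≤ max ((M : ℝ) - (m : ℝ) * (2 : ℝ) ^ ((2 : ℝ) ^ (-20 : ℤ) *
      ((n : ℝ) / ((k : ℝ) * Real.logb 2 ((n : ℝ) / (k : ℝ)))))) (0.6 * (M : ℝ)) := by
  rcases le_or_gt (#F : ℝ) (0.6 * M) with h06 | h06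
  · exact h06.trans (le_max_right _ _)
  refine le_trans ?_ (le_max_left _ _)
  rw [← div_div]
  set x : ℝ := (n : ℝ) / k with hx
  have hlog := two_pow_mul_log_le hk h1
  have hL := two_pow_mul_logb_sq_le hk h2
  rw [← hx] at hlog hL
  have hx13 : 2 ^ 13 ≤ x := by
    refine le_trans ?_ hlog
    push_cast
    nlinarith [(Nat.cast_nonneg (Nat.log 2 k) : (0 : ℝ) ≤ _)]
  obtain ⟨d, hd, hd'⟩ := exists_kernel_size hx13 ht hL
  have hMdeg : ∀ T : Finset (Fin N), #T = t → (avoidDegree C k T ∅ : ℝ) ≤ M := by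
    intro T hT
    rw [avoidDegree_empty]
    exact_mod_cast hM T hT
  have hF0 : 0 < #F := by
    have : (0 : ℝ) < #F := lt_of_le_of_lt (by positivity) h06
    exact_mod_cast this
  obtain ⟨A, hA⟩ := card_pos.1 hF0
  obtain ⟨T, hTA, hT⟩ := exists_subset_card_eq (le_trans (hint A hA A hA) (card_le_card
    inter_subset_left))
  have hM0 : (0 : ℝ) < M := by
    have : 0 < #{A ∈ C.slice k | T ⊆ A} := card_pos.2 ⟨A, mem_filter.2 ⟨hF hA, hTA⟩⟩
    exact_mod_cast this.trans_le (hM T hT)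
  have hmρ : 128 * ((Nat.log 2 k + 1 : ℕ) : ℝ) ≤ x - 2 := by
    norm_num at hx13 hlog ⊢
    linarith
  have hkm : k < 2 ^ (Nat.log 2 k + 1) := Nat.lt_pow_succ_log_self (by norm_num) k
  obtain ⟨T₀, hT₀, hout⟩ := exists_card_not_subset_le hk hC hrank le_rfl hMdeg ⟨T, hT⟩ hF hint
    (Nat.succ_pos _) hmρ hkm le_rfl hd hd'
  have hsum : (#{A ∈ F | T₀ ⊆ A} : ℝ) + #{A ∈ F | ¬ T₀ ⊆ A} = #F := by
    exact_mod_cast card_filter_add_card_filter_not _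
  have hmT₀ : (m : ℝ) ≤ #{A ∈ F | ¬ T₀ ⊆ A} := by exact_mod_cast hm T₀ hT₀
  rcases ({A ∈ F | ¬ T₀ ⊆ A}).eq_empty_or_nonempty with hH | hH
  · rw [hH, card_empty, Nat.cast_zero] at hmT₀ hsum
    have hm0 : (m : ℝ) = 0 := le_antisymm hmT₀ (Nat.cast_nonneg _)
    rw [hm0, zero_mul, sub_zero, ← hsum, add_zero]
    exact_mod_cast (card_le_card (filter_subset_filter _ hF)).trans (hM T₀ hT₀)
  · have htd : (t : ℝ) ≤ ((t + d : ℕ) : ℝ) := by exact_mod_cast Nat.le_add_right t d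
    have ht0 : (0 : ℝ) ≤ t := Nat.cast_nonneg _
    set E : ℝ := (2 : ℝ) ^ ((2 : ℝ) ^ (-20 : ℤ) * (x / Real.logb 2 x)) with hE
    have hE0 : 0 ≤ E := by positivity
    have hmain := card_not_subset_mul_add_le hk hC hrank le_rfl hMdeg hM0 hF hint
      (Nat.succ_pos _) hmρ hkm (by linarith) hE0 (stability_parameter hx13 ht hL) hT₀
      (by linarith) hH
    have := mul_le_mul_of_nonneg_right hmT₀ hE0
    linarith

end UniformHereditary

theorem theorem1 (N n k t : ℕ) (hN : 0 < N) (hn : 0 < n) (hk : 0 < k) (ht : 0 < t)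
    (h1 : (n : ℝ) ≥ 2 ^ 13 * (k : ℝ) * Real.logb 2 (2 * (k : ℝ)))
    (h2 : (n : ℝ) ≥ 2 ^ 19 * (t : ℝ) * (k : ℝ) * (Real.logb 2 ((n : ℝ) / (k : ℝ))) ^ 2)
    (C : Finset (Finset (Fin N))) (hC : UniformHereditary.IsComplex C)
    (hrank : UniformHereditary.RankGE C n)
    (F : Finset (Finset (Fin N))) (hF : F ⊆ C.slice k)
    (hint : UniformHereditary.IsTIntersecting t F) :
    (∃ T : Finset (Fin N), T.card = t ∧
      F.card ≤ (UniformHereditary.link (C.slice k) T).card) ∧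
    (∃ M m : ℕ,
      IsGreatest {x : ℕ | ∃ T : Finset (Fin N), T.card = t ∧
        x = (UniformHereditary.link (C.slice k) T).card} M ∧
      IsLeast {x : ℕ | ∃ T : Finset (Fin N), T.card = t ∧
        x = (F \ UniformHereditary.star (C.slice k) T).card} m ∧
      (F.card : ℝ) ≤ max
        ((M : ℝ) - (m : ℝ) *
          (2 : ℝ) ^ ((2 : ℝ) ^ (-20 : ℤ) *
            ((n : ℝ) / ((k : ℝ) * Real.logb 2 ((n : ℝ) / (k : ℝ))))))
        (0.6 * (M : ℝ))) := by
  open UniformHereditary Finset in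
  have htN : t ≤ N := by
    have hk' : (1 : ℝ) ≤ k := by exact_mod_cast hk
    have hx13 : (2 : ℝ) ^ 13 ≤ n / k := by
      refine le_trans ?_ (two_pow_mul_log_le hk h1)
      push_cast
      nlinarith [(Nat.cast_nonneg (Nat.log 2 k) : (0 : ℝ) ≤ _)]
    have hL := thirteen_le_logb hx13
    have h3 := two_pow_mul_logb_sq_le hk h2
    have h4 : (n : ℝ) / k ≤ n := div_le_self (Nat.cast_nonneg _) hk'
    have h5 : (t : ℝ) ≤ n := by
      have : (0 : ℝ) ≤ t := Nat.cast_nonneg _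
      nlinarith [mul_nonneg this (by nlinarith : 0 ≤ Real.logb 2 ((n : ℝ) / k) ^ 2 - 1)]
    obtain ⟨A, hA⟩ := hC.1
    obtain ⟨D, -, hD⟩ := exists_le_maximal C hA
    have h6 := (hrank D hD).trans (card_le_univ D)
    rw [Fintype.card_fin] at h6
    exact le_trans (by exact_mod_cast h5) h6
  obtain ⟨T', -, hT'⟩ := Finset.exists_subset_card_eq (s := (Finset.univ : Finset (Fin N)))
    (n := t) (by simpa using htN)
  have hne : (Finset.powersetCard t (Finset.univ : Finset (Fin N))).Nonempty :=
    ⟨T', by simp [hT']⟩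
  have hmem : ∀ T : Finset (Fin N), T ∈ Finset.powersetCard t Finset.univ ↔ T.card = t := by
    simp
  obtain ⟨T₁, hT₁, hmax⟩ := Finset.exists_max_image _
    (fun T => (UniformHereditary.link (C.slice k) T).card) hne
  obtain ⟨T₂, hT₂, hmin⟩ := Finset.exists_min_image _
    (fun T => (F \ UniformHereditary.star (C.slice k) T).card) hne
  simp only [hmem] at hT₁ hT₂ hmax hmin
  have hdiff : ∀ T : Finset (Fin N), F \ UniformHereditary.star (C.slice k) T =
      {A ∈ F | ¬ T ⊆ A} := by
    intro T
    ext A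
    simp only [UniformHereditary.star, Finset.mem_sdiff, Finset.mem_filter, not_and,
      and_congr_right_iff]
    exact fun hA => ⟨fun h => h (hF hA), fun h _ => h⟩
  have hbound := UniformHereditary.card_le_max_of_isTIntersecting hk ht h1 h2 hC hrank hF hint
    (M := (UniformHereditary.link (C.slice k) T₁).card)
    (m := (F \ UniformHereditary.star (C.slice k) T₂).card)
    (fun T hT => (UniformHereditary.card_link _ T).symm.trans_le (hmax T hT))
    (fun T hT => by rw [← hdiff]; exact hmin T hT)
  refine ⟨⟨T₁, hT₁, ?_⟩, _, _, ⟨⟨T₁, hT₁, rfl⟩, ?_⟩, ⟨⟨T₂, hT₂, rfl⟩, ?_⟩, hbound⟩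
  · have h3 := hbound.trans (max_le (c := ((UniformHereditary.link (C.slice k) T₁).card : ℝ))
      (sub_le_self _ (by positivity))
      (mul_le_of_le_one_left (Nat.cast_nonneg _) (by norm_num)))
    exact_mod_cast h3
  · rintro _ ⟨T, hT, rfl⟩
    exact hmax T hT
  · rintro _ ⟨T, hT, rfl⟩
    exact hmin T hT
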